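/- Let $n\ge 1$ be the number of qubits and let $\mu_H$ be the Haar probability measure on the unitary group $U(2^n)$ of $(\mathbb{C}^2)^{\otimes n}$. Let $\mathcal{P}_n=\{i^m P_1\otimes\cdots\otimes P_n : m\in\mathbb{Z},\ P_j\in\{\mathbb{1},X,Y,Z\}\}$ be the Pauli group and let $$\mathrm{Cl}(n)=\{U\in U(2^n) : \text{all entries of } U \text{ lie in } \mathbb{Z}[1/2,i] \text{ and } U\mathcal{P}_nU^\dagger\subset\mathcal{P}_n\}$$ be the $n$-qubit Clifford group (a finite group; the condition on the entries only fixes the global phase up to powers of $i$). Let $\mu_{\mathrm{Cl}}$ be the uniform probability measure on $\mathrm{Cl}(n)$, let $\mu_{H,1}$ be the Haar probability measure on the subgroup $U(2)\otimes\mathbb{1}_{n-1}$ acting on the first qubit, and let $\sigma=\mu_{\mathrm{Cl}}*\mu_{H,1}*\mu_{\mathrm{Cl}}$, where $*$ is the convolution of measures on $U(2^n)$; $\sigma^{*k}$ is the $k$-fold convolution power. For probability measures $\nu_1,\nu_2$ on $U(2^n)$ let $$W_{\mathrm{Fro},2}(\nu_1,\nu_2)=\inf\left\{\left(\mathbb{E}\,\|X-Y\|_F^2\right)^{1/2}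 : (X,Y)\text{ is a coupling of }\nu_1\text{ and }\nu_2\right\},$$ where $\|\cdot\|_F$ is the Frobenius norm. Then for every $k\ge 1$ $$W_{\mathrm{Fro},2}\big(\sigma^{*k},\mu_H\big)\le\left(1-\frac{3}{2^{2n}-1}\right)^{k/2}\pi\,2^{n/2}.$$ -/

import Mathlib

open MeasureTheory
open scoped ENNReal

noncomputable section

namespace CliffordWalk

/-! ### The unitary group as a compact measurable group -/

section Unitary

variable {ι : Type*} [Fintype ι] [DecidableEq ι]

/-- The Borel σ-algebra on the unitary group. -/
instance instMeasurableSpaceUnitary : MeasurableSpace (Matrix.unitaryGroup ι ℂ) := borel _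

instance instBorelSpaceUnitary : BorelSpace (Matrix.unitaryGroup ι ℂ) := ⟨rfl⟩

instance instCompactSpaceUnitary : CompactSpace (Matrix.unitaryGroup ι ℂ) := by
  have hK : IsCompact (Set.pi Set.univ
      (fun _ : ι => Set.pi Set.univ (fun _ : ι => Metric.closedBall (0 : ℂ) 1))) :=
    isCompact_univ_pi fun _ => isCompact_univ_pi fun _ => isCompact_closedBall 0 1
  have hC : IsClosed ((Matrix.unitaryGroup ι ℂ : Submonoid (Matrix ι ι ℂ)) : Set (Matrix ι ι ℂ)) :=
    isClosed_unitary
  refine isCompact_iff_compactSpace.mp (hK.of_isClosed_subset hC ?_)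
  intro U hU i _ j _
  simpa using entry_norm_bound_of_unitary hU i j

/-- The Haar probability measure on the unitary group, i.e. the left-invariant measure
of total mass one. -/
def haar (ι : Type*) [Fintype ι] [DecidableEq ι] : Measure (Matrix.unitaryGroup ι ℂ) :=
  Measure.haarMeasure ⊤

/-- The distance `‖U - V‖_F` induced by the Frobenius norm. -/
def frobeniusDist (U V : Matrix.unitaryGroup ι ℂ) : ℝ :=
  letI : NormedAddCommGroup (Matrix ι ι ℂ) := Matrix.frobeniusNormedAddCommGroup
  ‖(U : Matrix ι ι ℂ) - (V : Matrix ι ι ℂ)‖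

end Unitary

/-! ### Wasserstein distance and convolution powers -/

/-- `γ` is (the joint law of) a coupling of `μ` and `ν`. -/
def IsCoupling {X : Type*} [MeasurableSpace X] (γ : Measure (X × X)) (μ ν : Measure X) : Prop :=
  γ.map Prod.fst = μ ∧ γ.map Prod.snd = ν

/-- The `p`-Wasserstein distance with respect to the distance `d`: the infimum of
`(𝔼 d(X, Y) ^ p) ^ (1 / p)` over all couplings `(X, Y)`, with values in `[0, ∞]`. -/
def wasserstein {X : Type*} [MeasurableSpace X] (d : X → X → ℝ) (p : ℝ) (μ ν : Measure X) :
    ℝ≥0∞ :=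
  ⨅ (γ : Measure (X × X)) (_ : IsCoupling γ μ ν),
    (∫⁻ z, ENNReal.ofReal (d z.1 z.2) ^ p ∂γ) ^ (1 / p)

/-- The `k`-fold convolution power of a measure on a monoid. -/
def convPow {G : Type*} [Monoid G] [MeasurableSpace G] (ν : Measure G) : ℕ → Measure G
  | 0 => Measure.dirac 1
  | k + 1 => Measure.mconv (convPow ν k) ν

/-! ### Qubits -/

/-- Labels `x ∈ {0,1}^n` of the computational basis of `(ℂ²)^{⊗ n}`. -/
abbrev Bits (n : ℕ) : Type := Fin n → Fin 2

/-- The tensor product `A₁ ⊗ ⋯ ⊗ Aₙ`, as a matrix in the computational basis. -/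
def tensor {n : ℕ} (A : Fin n → Matrix (Fin 2) (Fin 2) ℂ) : Matrix (Bits n) (Bits n) ℂ :=
  Matrix.of fun x y => ∏ j, A j (x j) (y j)

lemma tensor_mul {n : ℕ} (A B : Fin n → Matrix (Fin 2) (Fin 2) ℂ) :
    tensor A * tensor B = tensor (fun j => A j * B j) := by
  ext x y
  simp only [tensor, Matrix.mul_apply, Matrix.of_apply, ← Finset.prod_mul_distrib]
  rw [Finset.prod_univ_sum, Fintype.piFinset_univ]

lemma tensor_one {n : ℕ} : tensor (fun _ : Fin n => 1) = 1 := by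
  ext x y
  simp only [tensor, Matrix.of_apply, Matrix.one_apply, Finset.prod_boole, Finset.mem_univ,
    true_implies, funext_iff]

lemma star_tensor {n : ℕ} (A : Fin n → Matrix (Fin 2) (Fin 2) ℂ) :
    star (tensor A) = tensor (fun j => star (A j)) := by
  ext x y
  simp [tensor, Matrix.star_apply]

lemma tensor_mem_unitaryGroup {n : ℕ} {A : Fin n → Matrix (Fin 2) (Fin 2) ℂ}
    (hA : ∀ j, A j ∈ Matrix.unitaryGroup (Fin 2) ℂ) :
    tensor A ∈ Matrix.unitaryGroup (Bits n) ℂ := by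
  rw [Matrix.mem_unitaryGroup_iff, star_tensor, tensor_mul, ← tensor_one]
  congr 1
  funext j
  exact Matrix.mem_unitaryGroup_iff.mp (hA j)

/-- The unitary `U ⊗ 𝟙_{n-1}`, acting by `U` on the first of `n ≥ 1` qubits. -/
def onFirstQubit (n : ℕ) (U : Matrix.unitaryGroup (Fin 2) ℂ) : Matrix.unitaryGroup (Bits n) ℂ :=
  ⟨tensor fun j : Fin n => if (j : ℕ) = 0 then (U : Matrix (Fin 2) (Fin 2) ℂ) else 1, by
    refine tensor_mem_unitaryGroup fun j => ?_
    split_ifs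
    · exact U.2
    · exact one_mem _⟩

/-- The Haar probability measure `μ_{H,1}` on the subgroup `U(2) ⊗ 𝟙_{n-1}`, transported from
`U(2)` along `U ↦ U ⊗ 𝟙_{n-1}`. -/
def haarFirstQubit (n : ℕ) : Measure (Matrix.unitaryGroup (Bits n) ℂ) :=
  (haar (Fin 2)).map (onFirstQubit n)

/-- The matrices `𝟙, X, Y, Z`. -/
def pauli : Fin 4 → Matrix (Fin 2) (Fin 2) ℂ :=
  ![1, !![0, 1; 1, 0], !![0, -Complex.I; Complex.I, 0], !![1, 0; 0, -1]]

/-- The `n`-qubit Pauli group: all `i^m P₁ ⊗ ⋯ ⊗ Pₙ` with each `Pⱼ` one of `𝟙, X, Y, Z`. -/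
def pauliGroup (n : ℕ) : Set (Matrix (Bits n) (Bits n) ℂ) :=
  {A | ∃ (m : ℕ) (s : Fin n → Fin 4), A = Complex.I ^ m • tensor fun j => pauli (s j)}

/-- The subring `ℤ[1/2, i]` of `ℂ`. -/
def gaussianDyadic : Subring ℂ := Subring.closure {(2 : ℂ)⁻¹, Complex.I}

/-- The `n`-qubit Clifford group: the unitaries that normalize the Pauli group and have entries
in `ℤ[1/2, i]`. The condition on the entries only serves to fix the global phase up to powers of
`i`, so as to have a finite group: every unitary normalizing the Pauli group is a scalar multiple
of an element of this group. (Entries in the field `ℚ[i]` would still admit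
infinitely many scalars, such as `(3 + 4i)/5`.) -/
def cliffordGroup (n : ℕ) : Set (Matrix.unitaryGroup (Bits n) ℂ) :=
  {U | (∀ x y, (U : Matrix (Bits n) (Bits n) ℂ) x y ∈ gaussianDyadic) ∧
    ∀ P ∈ pauliGroup n,
      (U : Matrix (Bits n) (Bits n) ℂ) * P * star (U : Matrix (Bits n) (Bits n) ℂ) ∈ pauliGroup n}

/-- The uniform probability measure on the (finite) Clifford group. -/
def cliffordMeasure (n : ℕ) : Measure (Matrix.unitaryGroup (Bits n) ℂ) :=
  ProbabilityTheory.uniformOn (cliffordGroup n)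

/-- One step `σ = μ_Cl * μ_{H,1} * μ_Cl` of the walk. -/
def sigma (n : ℕ) : Measure (Matrix.unitaryGroup (Bits n) ℂ) :=
  Measure.mconv (Measure.mconv (cliffordMeasure n) (haarFirstQubit n)) (cliffordMeasure n)

end CliffordWalk

end

/-! The proof is a path coupling. A Haar random `U` is joined to `1` by a path of m + 1 steps, each
of Frobenius length at most δ = π 2^{n/2} / m, and the walk is run from all points of the path with
shared randomness. The start of the path then has law σ^{*k}, while its end stays Haar distributed.
By Cauchy–Schwarz the squared distance of the ends is at most the number of segments times the sum
of their squared lengths, so it suffices to bound the mean squared length (`energy`) of one segment.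

One step sends γ_j to γ_j c (V_j u ⊗ 𝟙) c'. Left invariance of Haar measure on U(2) lets V_j depend
on the path and on c without changing the law of any single point (`map_eval_step`). With E = c⁻¹
γ_j⁻¹ γ_{j+1} c, neighbouring points end at distance ‖E (W ⊗ 𝟙) - 1‖, where W = V_{j+1} V_j⁻¹ is
free. For E close to 1, K = E - 1 is skew-Hermitian up to second order, and taking W to be the
Cayley transform of its first-qubit part cancels that part to first order
(`frobeniusDist_correction_sq_le`).

Clifford unitaries act transitively on the 4^n - 1 nontrivial Pauli strings
(`exists_clifford_conj`), so conjugation by a random c spreads the squared norm of K on these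
strings evenly; three of them live on the first qubit (`le_integral_firstQubitWeight`). Hence a step
multiplies the energy by at most 1 - 3/(4^n - 1), up to O(δ³) (`energy_step_le`). After k steps the
error is C(δ³ + δ⁴) with C independent of m; multiplied by (m + 1)² it vanishes as m → ∞. -/

noncomputable section

namespace CliffordWalk

/-! ### Frobenius norm and its bi-invariant distance -/

section Frobenius

open scoped Matrix.Norms.Frobenius

variable {ι : Type*} [Fintype ι] [DecidableEq ι]

lemma frobenius_sq (A : Matrix ι ι ℂ) : ‖A‖ ^ 2 = ∑ x, ∑ y, ‖A x y‖ ^ 2 := by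
  rw [Matrix.frobenius_norm_def, ← Real.sqrt_eq_rpow, Real.sq_sqrt (by positivity)]
  simp

lemma frobenius_sq_eq_trace (A : Matrix ι ι ℂ) : ‖A‖ ^ 2 = (Matrix.trace (star A * A)).re := by
  rw [frobenius_sq, Finset.sum_comm]
  simp only [Matrix.trace, Matrix.diag_apply, Matrix.mul_apply, Matrix.star_apply, Complex.re_sum]
  refine Finset.sum_congr rfl fun x _ => Finset.sum_congr rfl fun y _ => ?_
  rw [Complex.star_def, ← Complex.normSq_eq_conj_mul_self, Complex.ofReal_re,
    Complex.normSq_eq_norm_sq]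

lemma frobenius_star (A : Matrix ι ι ℂ) : ‖star A‖ = ‖A‖ := Matrix.frobenius_norm_conjTranspose A

lemma frobenius_mul_unitary (A : Matrix ι ι ℂ) {U : Matrix ι ι ℂ}
    (hU : U ∈ Matrix.unitaryGroup ι ℂ) : ‖A * U‖ = ‖A‖ := by
  refine (sq_eq_sq₀ (norm_nonneg _) (norm_nonneg _)).mp ?_
  rw [frobenius_sq_eq_trace, frobenius_sq_eq_trace, star_mul, mul_assoc, Matrix.trace_mul_comm,
    mul_assoc, mul_assoc, Matrix.mem_unitaryGroup_iff.mp hU, mul_one]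

lemma frobenius_unitary_mul (A : Matrix ι ι ℂ) {U : Matrix ι ι ℂ}
    (hU : U ∈ Matrix.unitaryGroup ι ℂ) : ‖U * A‖ = ‖A‖ := by
  rw [← frobenius_star, star_mul, frobenius_mul_unitary _ (Unitary.star_mem hU), frobenius_star]

lemma re_trace_star_mul_comm (A B : Matrix ι ι ℂ) :
    (Matrix.trace (star B * A)).re = (Matrix.trace (star A * B)).re := by
  have h : star B * A = Matrix.conjTranspose (star A * B) := by
    rw [← Matrix.star_eq_conjTranspose, star_mul, star_star]
  rw [h, Matrix.trace_conjTranspose]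
  simp

lemma frobenius_add_sq (A B : Matrix ι ι ℂ) :
    ‖A + B‖ ^ 2 = ‖A‖ ^ 2 + 2 * (Matrix.trace (star A * B)).re + ‖B‖ ^ 2 := by
  simp only [frobenius_sq_eq_trace, star_add, add_mul, mul_add, Matrix.trace_add, Complex.add_re]
  rw [re_trace_star_mul_comm A B]
  ring

lemma frobenius_sub_sq (A B : Matrix ι ι ℂ) :
    ‖A - B‖ ^ 2 = ‖A‖ ^ 2 - 2 * (Matrix.trace (star A * B)).re + ‖B‖ ^ 2 := by
  rw [sub_eq_add_neg, frobenius_add_sq, norm_neg, mul_neg, Matrix.trace_neg, Complex.neg_re]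
  ring

lemma abs_re_trace_star_mul_le (A B : Matrix ι ι ℂ) :
    |(Matrix.trace (star A * B)).re| ≤ (‖A‖ ^ 2 + ‖B‖ ^ 2) / 2 := by
  have h1 := frobenius_add_sq A B
  have h2 := frobenius_sub_sq A B
  rw [abs_le]
  constructor <;> nlinarith [sq_nonneg ‖A + B‖, sq_nonneg ‖A - B‖]

lemma frobenius_one_sq : ‖(1 : Matrix ι ι ℂ)‖ ^ 2 = Fintype.card ι := by
  rw [frobenius_sq_eq_trace]
  simp

lemma frobenius_unitary_sq {U : Matrix ι ι ℂ} (hU : U ∈ Matrix.unitaryGroup ι ℂ) :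
    ‖U‖ ^ 2 = Fintype.card ι := by
  rw [← mul_one U, frobenius_unitary_mul _ hU, frobenius_one_sq]

/-- Right multiplication by `1 + B` with `B` skew-Hermitian does not decrease the norm. -/
lemma frobenius_le_mul_one_add_skew (A : Matrix ι ι ℂ) {B : Matrix ι ι ℂ} (hB : star B = -B) :
    ‖A‖ ≤ ‖A * (1 + B)‖ := by
  -- The cross term vanishes because `star A * A` is Hermitian and `B` is skew-Hermitian.
  have h0 : (Matrix.trace (star A * (A * B))).re = 0 := by
    have h := re_trace_star_mul_comm A (A * B)
    rw [star_mul, hB, mul_assoc, neg_mul, Matrix.trace_neg, Matrix.trace_mul_comm, mul_assoc,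
      Complex.neg_re] at h
    linarith
  have h := frobenius_add_sq A (A * B)
  rw [h0] at h
  rw [mul_add, mul_one]
  exact (abs_le_of_sq_le_sq' (by nlinarith [sq_nonneg ‖A * B‖]) (norm_nonneg _)).2

/-- `W` is the Cayley transform of `B`, which agrees with exp(-B) to second order. Multiplying by 1
+ B/2 clears its denominator, leaves K - B - KB/2, and cannot decrease the norm. -/
lemma frobenius_cayley_le (K B W : Matrix ι ι ℂ) (hB : star B = -B)
    (hW : W * (1 + (2⁻¹ : ℂ) • B) = 1 - (2⁻¹ : ℂ) • B) :
    ‖(1 + K) * W - 1‖ ≤ ‖K - B‖ + 2⁻¹ * (‖K‖ * ‖B‖) := by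
  have hB2 : star ((2⁻¹ : ℂ) • B) = -((2⁻¹ : ℂ) • B) := by
    rw [star_smul, hB]; simp
  have e : ((1 + K) * W - 1) * (1 + (2⁻¹ : ℂ) • B) = (K - B) - (2⁻¹ : ℂ) • (K * B) := by
    rw [sub_mul, mul_assoc, hW, one_mul, add_mul, mul_sub, mul_one, one_mul, mul_sub, mul_one,
      mul_smul_comm]
    have : B = (2⁻¹ : ℂ) • B + (2⁻¹ : ℂ) • B := by rw [← add_smul]; norm_num
    nth_rw 4 [this]
    abel
  calc _ ≤ ‖((1 + K) * W - 1) * (1 + (2⁻¹ : ℂ) • B)‖ := frobenius_le_mul_one_add_skew _ hB2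
    _ = ‖(K - B) - (2⁻¹ : ℂ) • (K * B)‖ := by rw [e]
    _ ≤ ‖K - B‖ + ‖(2⁻¹ : ℂ) • (K * B)‖ := norm_sub_le _ _
    _ ≤ ‖K - B‖ + 2⁻¹ * (‖K‖ * ‖B‖) := by
      rw [norm_smul]
      gcongr
      · simp
      · exact Matrix.frobenius_norm_mul _ _

lemma frobeniusDist_eq (U V : Matrix.unitaryGroup ι ℂ) :
    frobeniusDist U V = ‖(U : Matrix ι ι ℂ) - (V : Matrix ι ι ℂ)‖ := rfl

lemma frobeniusDist_nonneg (U V : Matrix.unitaryGroup ι ℂ) : 0 ≤ frobeniusDist U V := by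
  rw [frobeniusDist_eq]; exact norm_nonneg _

lemma frobeniusDist_self (U : Matrix.unitaryGroup ι ℂ) : frobeniusDist U U = 0 := by
  rw [frobeniusDist_eq]; simp

lemma frobeniusDist_comm (U V : Matrix.unitaryGroup ι ℂ) :
    frobeniusDist U V = frobeniusDist V U := by
  rw [frobeniusDist_eq, frobeniusDist_eq]; exact norm_sub_rev _ _

lemma frobeniusDist_triangle (U V W : Matrix.unitaryGroup ι ℂ) :
    frobeniusDist U W ≤ frobeniusDist U V + frobeniusDist V W := by
  simp only [frobeniusDist_eq]; exact norm_sub_le_norm_sub_add_norm_sub _ _ _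

lemma frobeniusDist_mul_left (g U V : Matrix.unitaryGroup ι ℂ) :
    frobeniusDist (g * U) (g * V) = frobeniusDist U V := by
  simp only [frobeniusDist_eq, Matrix.UnitaryGroup.mul_val, ← mul_sub]
  exact frobenius_unitary_mul _ g.2

lemma frobeniusDist_mul_right (U V g : Matrix.unitaryGroup ι ℂ) :
    frobeniusDist (U * g) (V * g) = frobeniusDist U V := by
  simp only [frobeniusDist_eq, Matrix.UnitaryGroup.mul_val, ← sub_mul]
  exact frobenius_mul_unitary _ g.2

lemma frobeniusDist_sq (U V : Matrix.unitaryGroup ι ℂ) :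
    frobeniusDist U V ^ 2 =
      ∑ x, ∑ y, ‖(U : Matrix ι ι ℂ) x y - (V : Matrix ι ι ℂ) x y‖ ^ 2 := by
  rw [frobeniusDist_eq, frobenius_sq]; rfl

lemma frobeniusDist_le (U V : Matrix.unitaryGroup ι ℂ) :
    frobeniusDist U V ≤ 2 * √(Fintype.card ι) := by
  have key (W : Matrix.unitaryGroup ι ℂ) : ‖(W : Matrix ι ι ℂ)‖ = √(Fintype.card ι) := by
    rw [← frobenius_unitary_sq W.2, Real.sqrt_sq (norm_nonneg _)]
  rw [frobeniusDist_eq, two_mul]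
  refine (norm_sub_le _ _).trans ?_
  rw [key, key]

end Frobenius

section Dist

variable {ι : Type*} [Fintype ι] [DecidableEq ι]

lemma continuous_entry (x y : ι) :
    Continuous fun U : Matrix.unitaryGroup ι ℂ => (U : Matrix ι ι ℂ) x y :=
  (continuous_apply_apply x y).comp continuous_subtype_val

lemma continuous_frobeniusDist {X : Type*} [TopologicalSpace X]
    {f g : X → Matrix.unitaryGroup ι ℂ} (hf : Continuous f) (hg : Continuous g) :
    Continuous fun z => frobeniusDist (f z) (g z) := by
  have h : (fun z => frobeniusDist (f z) (g z)) =
      fun z => √(∑ x, ∑ y, ‖(f z : Matrix ι ι ℂ) x y - (g z : Matrix ι ι ℂ) x y‖ ^ 2) := by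
    funext z
    rw [← frobeniusDist_sq, Real.sqrt_sq (frobeniusDist_nonneg _ _)]
  rw [h]
  refine Real.continuous_sqrt.comp ?_
  refine continuous_finsetSum _ fun x _ => continuous_finsetSum _ fun y _ => ?_
  exact ((((continuous_entry x y).comp hf).sub ((continuous_entry x y).comp hg)).norm).pow 2

lemma frobeniusDist_le_sum (p : ℕ → Matrix.unitaryGroup ι ℂ) (m : ℕ) :
    frobeniusDist (p 0) (p m) ≤ ∑ j ∈ Finset.range m, frobeniusDist (p j) (p (j + 1)) := by
  induction m with
  | zero => simp [frobeniusDist_self]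
  | succ m ih =>
    rw [Finset.sum_range_succ]
    exact (frobeniusDist_triangle _ (p m) _).trans (by gcongr)

end Dist

/-! ### Algebra of the single-qubit Pauli matrices -/

section SingleQubit

lemma star_pauli (a : Fin 4) : star (pauli a) = pauli a := by
  fin_cases a <;> ext i j <;> fin_cases i <;> fin_cases j <;> simp [pauli, Matrix.star_apply]

lemma pauli_mul_self (a : Fin 4) : pauli a * pauli a = 1 := by
  fin_cases a <;> ext i j <;> fin_cases i <;> fin_cases j <;>
    simp [pauli, Matrix.mul_apply, Fin.sum_univ_two]

/-- The sign by which two Pauli matrices commute. -/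
def pauliSign (a b : Fin 4) : ℂ := if a = 0 ∨ b = 0 ∨ a = b then 1 else -1

lemma pauliSign_eq (a b : Fin 4) : pauliSign a b = 1 ∨ pauliSign a b = -1 := by
  unfold pauliSign; split_ifs <;> simp

lemma pauli_mul_comm (a b : Fin 4) :
    pauli a * pauli b = pauliSign a b • (pauli b * pauli a) := by
  fin_cases a <;> fin_cases b <;> ext i j <;> fin_cases i <;> fin_cases j <;>
    simp [pauli, pauliSign, Matrix.mul_apply, Fin.sum_univ_two]

lemma exists_pauli_mul (a b : Fin 4) :
    ∃ (m : ℕ) (c : Fin 4), pauli a * pauli b = Complex.I ^ m • pauli c := by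
  have key : ∀ a b : Fin 4, a ≠ 0 → b ≠ 0 → a ≠ b →
      ∃ (m : Fin 4) (c : Fin 4), pauli a * pauli b = Complex.I ^ (m : ℕ) • pauli c := by
    intro a b ha hb hab
    have h3 : Complex.I ^ 3 = -Complex.I := Complex.I_pow_three
    fin_cases a <;> fin_cases b <;> simp at ha hb hab
    · exact ⟨1, 3, by ext i j; fin_cases i <;> fin_cases j <;>
        simp [pauli, Matrix.mul_apply, Fin.sum_univ_two]⟩
    · exact ⟨3, 2, by ext i j; fin_cases i <;> fin_cases j <;>
        simp [pauli, Matrix.mul_apply, Fin.sum_univ_two, h3]⟩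
    · exact ⟨3, 3, by ext i j; fin_cases i <;> fin_cases j <;>
        simp [pauli, Matrix.mul_apply, Fin.sum_univ_two, h3]⟩
    · exact ⟨1, 1, by ext i j; fin_cases i <;> fin_cases j <;>
        simp [pauli, Matrix.mul_apply, Fin.sum_univ_two]⟩
    · exact ⟨1, 2, by ext i j; fin_cases i <;> fin_cases j <;>
        simp [pauli, Matrix.mul_apply, Fin.sum_univ_two]⟩
    · exact ⟨3, 1, by ext i j; fin_cases i <;> fin_cases j <;>
        simp [pauli, Matrix.mul_apply, Fin.sum_univ_two, h3]⟩
  by_cases ha : a = 0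
  · exact ⟨0, b, by subst ha; simp [pauli]⟩
  by_cases hb : b = 0
  · exact ⟨0, a, by subst hb; simp [pauli]⟩
  by_cases hab : a = b
  · exact ⟨0, 0, by subst hab; rw [pauli_mul_self]; simp [pauli]⟩
  · obtain ⟨m, c, h⟩ := key a b ha hb hab
    exact ⟨m, c, h⟩

lemma sum_pauli_mul_conj (x y x' y' : Fin 2) :
    ∑ a, pauli a x y * star (pauli a x' y') = if x = x' ∧ y = y' then 2 else 0 := by
  rw [Fin.sum_univ_four]
  fin_cases x <;> fin_cases y <;> fin_cases x' <;> fin_cases y' <;> simp [pauli] <;> norm_num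

lemma trace_pauli_mul (a b : Fin 4) :
    Matrix.trace (pauli a * pauli b) = if a = b then 2 else 0 := by
  fin_cases a <;> fin_cases b <;>
    simp [pauli, Matrix.trace, Fin.sum_univ_two] <;> norm_num

lemma pauli_mem_gaussianDyadic (a : Fin 4) (x y : Fin 2) : pauli a x y ∈ gaussianDyadic := by
  have hI : Complex.I ∈ gaussianDyadic := Subring.subset_closure (by simp)
  fin_cases a <;> fin_cases x <;> fin_cases y <;>
    simp [pauli, hI, zero_mem, one_mem]

end SingleQubit

/-! ### Pauli strings as an orthogonal basis -/

section Tensor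

variable {n : ℕ}

lemma tensor_smul (c : Fin n → ℂ) (A : Fin n → Matrix (Fin 2) (Fin 2) ℂ) :
    tensor (fun j => c j • A j) = (∏ j, c j) • tensor A := by
  ext x y
  simp [tensor, Finset.prod_mul_distrib]

lemma trace_tensor (A : Fin n → Matrix (Fin 2) (Fin 2) ℂ) :
    Matrix.trace (tensor A) = ∏ j, Matrix.trace (A j) := by
  simp only [Matrix.trace, Matrix.diag_apply, tensor, Matrix.of_apply]
  rw [Finset.prod_univ_sum, Fintype.piFinset_univ]

/-- The Pauli string `P₁ ⊗ ⋯ ⊗ Pₙ` with label `s`. -/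
def pauliString (s : Fin n → Fin 4) : Matrix (Bits n) (Bits n) ℂ := tensor fun j => pauli (s j)

lemma pauliString_mem_pauliGroup (s : Fin n → Fin 4) : pauliString s ∈ pauliGroup n :=
  ⟨0, s, by simp [pauliString]⟩

lemma star_pauliString (s : Fin n → Fin 4) : star (pauliString s) = pauliString s := by
  simp [pauliString, star_tensor, star_pauli]

lemma pauliString_mul_self (s : Fin n → Fin 4) : pauliString s * pauliString s = 1 := by
  simp [pauliString, tensor_mul, pauli_mul_self, tensor_one]

lemma pauliString_zero : pauliString (0 : Fin n → Fin 4) = 1 := by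
  simp [pauliString, ← tensor_one, pauli]

lemma pauliString_mem_unitaryGroup (s : Fin n → Fin 4) :
    pauliString s ∈ Matrix.unitaryGroup (Bits n) ℂ := by
  rw [Matrix.mem_unitaryGroup_iff, star_pauliString, pauliString_mul_self]

/-- The sign by which two Pauli strings commute. -/
def stringSign (s t : Fin n → Fin 4) : ℂ := ∏ j, pauliSign (s j) (t j)

lemma stringSign_eq (s t : Fin n → Fin 4) : stringSign s t = 1 ∨ stringSign s t = -1 := by
  unfold stringSign
  refine Finset.prod_induction _ (fun z : ℂ => z = 1 ∨ z = -1) ?_ (Or.inl rfl)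
    fun j _ => pauliSign_eq _ _
  rintro a b (rfl | rfl) (rfl | rfl) <;> simp

lemma pauliString_mul_comm (s t : Fin n → Fin 4) :
    pauliString s * pauliString t = stringSign s t • (pauliString t * pauliString s) := by
  simp only [pauliString, tensor_mul, stringSign, ← tensor_smul, ← pauli_mul_comm]

lemma card_bits : Fintype.card (Bits n) = 2 ^ n := by simp [Bits]

lemma trace_pauliString_mul (s t : Fin n → Fin 4) :
    Matrix.trace (pauliString s * pauliString t) = if s = t then 2 ^ n else 0 := by
  simp only [pauliString, tensor_mul, trace_tensor, trace_pauli_mul]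
  split_ifs with h
  · simp [h]
  · obtain ⟨j, hj⟩ := Function.ne_iff.mp h
    exact Finset.prod_eq_zero (Finset.mem_univ j) (by simp [hj])

/-- Completeness relation behind Parseval: the sum over strings factors into single-qubit sums over
the four Pauli matrices. -/
lemma sum_pauliString_mul_conj (x y x' y' : Bits n) :
    ∑ s, pauliString s x y * star (pauliString s x' y') =
      if x = x' ∧ y = y' then 2 ^ n else 0 := by
  simp only [pauliString, tensor, Matrix.of_apply, star_prod, ← Finset.prod_mul_distrib]
  rw [← Fintype.piFinset_univ, ← Finset.prod_univ_sum (fun _ : Fin n => Finset.univ)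
    (fun j a => pauli a (x j) (y j) * star (pauli a (x' j) (y' j)))]
  simp only [sum_pauli_mul_conj]
  split_ifs with h
  · simp [h.1, h.2]
  · have : ∃ j, ¬ (x j = x' j ∧ y j = y' j) := by
      by_contra! hc
      exact h ⟨funext fun j => (hc j).1, funext fun j => (hc j).2⟩
    obtain ⟨j, hj⟩ := this
    exact Finset.prod_eq_zero (Finset.mem_univ j) (by simp [hj])

open scoped Matrix.Norms.Frobenius in
/-- The Parseval identity for the basis of Pauli strings. -/
lemma sum_norm_sq_trace_pauliString_mul (K : Matrix (Bits n) (Bits n) ℂ) :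
    ∑ s, ‖Matrix.trace (pauliString s * K)‖ ^ 2 = 2 ^ n * ‖K‖ ^ 2 := by
  have tr (s : Fin n → Fin 4) : Matrix.trace (pauliString s * K) =
      ∑ z : Bits n × Bits n, pauliString s z.1 z.2 * K z.2 z.1 := by
    rw [Fintype.sum_prod_type]; rfl
  have h : (∑ s, Matrix.trace (pauliString s * K) * star (Matrix.trace (pauliString s * K)) : ℂ) =
      2 ^ n * ∑ z : Bits n × Bits n, K z.2 z.1 * star (K z.2 z.1) := by
    calc _ = ∑ s, ∑ z : Bits n × Bits n, ∑ w : Bits n × Bits n,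
          (pauliString s z.1 z.2 * star (pauliString s w.1 w.2)) *
            (K z.2 z.1 * star (K w.2 w.1)) := by
          refine Finset.sum_congr rfl fun s _ => ?_
          rw [tr, star_sum, Finset.sum_mul_sum]
          refine Finset.sum_congr rfl fun z _ => Finset.sum_congr rfl fun w _ => ?_
          rw [star_mul']
          ring
      _ = ∑ z : Bits n × Bits n, ∑ w : Bits n × Bits n,
          (if z = w then 2 ^ n else 0) * (K z.2 z.1 * star (K w.2 w.1)) := by
          rw [Finset.sum_comm]
          refine Finset.sum_congr rfl fun z _ => ?_
          rw [Finset.sum_comm]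
          refine Finset.sum_congr rfl fun w _ => ?_
          rw [← Finset.sum_mul, sum_pauliString_mul_conj]
          simp only [Prod.ext_iff]
      _ = _ := by
          rw [Finset.mul_sum]
          refine Finset.sum_congr rfl fun z _ => ?_
          simp
  have h3 (z : ℂ) : z * star z = ((‖z‖ ^ 2 : ℝ) : ℂ) := by
    rw [Complex.star_def, Complex.mul_conj, Complex.normSq_eq_norm_sq]
  simp only [h3] at h
  rw [frobenius_sq, Finset.sum_comm, ← Fintype.sum_prod_type']
  exact_mod_cast h

end Tensor

/-! ### Clifford group: transitivity on Pauli strings and finiteness -/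

section CliffordGroup

variable {n : ℕ}

lemma pauliGroup_smul_I {A : Matrix (Bits n) (Bits n) ℂ} (hA : A ∈ pauliGroup n) (k : ℕ) :
    Complex.I ^ k • A ∈ pauliGroup n := by
  obtain ⟨m, s, rfl⟩ := hA
  exact ⟨k + m, s, by rw [smul_smul, pow_add]⟩

lemma pauliGroup_neg {A : Matrix (Bits n) (Bits n) ℂ} (hA : A ∈ pauliGroup n) :
    -A ∈ pauliGroup n := by
  simpa using pauliGroup_smul_I hA 2

lemma pauliGroup_mul {A B : Matrix (Bits n) (Bits n) ℂ} (hA : A ∈ pauliGroup n)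
    (hB : B ∈ pauliGroup n) : A * B ∈ pauliGroup n := by
  obtain ⟨m, s, rfl⟩ := hA
  obtain ⟨m', t, rfl⟩ := hB
  choose k c h using exists_pauli_mul
  refine ⟨m + m' + ∑ j, k (s j) (t j), fun j => c (s j) (t j), ?_⟩
  rw [smul_mul_smul_comm, tensor_mul]
  simp only [h]
  rw [tensor_smul (fun j => Complex.I ^ k (s j) (t j)), smul_smul, Finset.prod_pow_eq_pow_sum,
    pow_add, pow_add]

lemma pauliGroup_finite : (pauliGroup n).Finite := by
  refine (Set.finite_range fun z : Fin 4 × (Fin n → Fin 4) =>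
    Complex.I ^ (z.1 : ℕ) • pauliString z.2).subset ?_
  rintro _ ⟨m, s, rfl⟩
  refine ⟨(⟨m % 4, Nat.mod_lt _ (by norm_num)⟩, s), ?_⟩
  simp only [pauliString]
  rw [← Complex.I_pow_eq_pow_mod]

lemma pauliGroup_commute_or (s : Fin n → Fin 4) {A : Matrix (Bits n) (Bits n) ℂ}
    (hA : A ∈ pauliGroup n) :
    A * pauliString s = pauliString s * A ∨ A * pauliString s = -(pauliString s * A) := by
  obtain ⟨m, t, rfl⟩ := hA
  have h := pauliString_mul_comm t s
  simp only [pauliString] at h ⊢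
  rw [smul_mul_assoc, mul_smul_comm, h]
  rcases stringSign_eq t s with e | e <;> rw [e] <;> simp

lemma cliffordGroup_mul {U V : Matrix.unitaryGroup (Bits n) ℂ} (hU : U ∈ cliffordGroup n)
    (hV : V ∈ cliffordGroup n) : U * V ∈ cliffordGroup n := by
  refine ⟨fun x y => ?_, fun P hP => ?_⟩
  · rw [Matrix.UnitaryGroup.mul_val, Matrix.mul_apply]
    exact Subring.sum_mem _ fun z _ => Subring.mul_mem _ (hU.1 x z) (hV.1 z y)
  · have := hU.2 _ (hV.2 P hP)
    rw [Matrix.UnitaryGroup.mul_val, star_mul]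
    simpa only [mul_assoc] using this

lemma one_mem_cliffordGroup : (1 : Matrix.unitaryGroup (Bits n) ℂ) ∈ cliffordGroup n := by
  refine ⟨fun x y => ?_, fun P hP => by simpa using hP⟩
  rw [Matrix.UnitaryGroup.one_val, Matrix.one_apply]
  split_ifs
  · exact one_mem _
  · exact zero_mem _

lemma pauliString_apply_mem (s : Fin n → Fin 4) (x y : Bits n) :
    pauliString s x y ∈ gaussianDyadic := by
  simp only [pauliString, tensor, Matrix.of_apply]
  exact Subring.prod_mem _ fun j _ => pauli_mem_gaussianDyadic (s j) (x j) (y j)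

/-- For anticommuting Pauli strings `P`, `Q`, the unitary `e^{iπ/4} (P + Q) / √2` is a Clifford
unitary that conjugates `P` to `Q`. -/
lemma exists_clifford_of_anticommute {s t : Fin n → Fin 4} (h : stringSign s t = -1) :
    ∃ g ∈ cliffordGroup n, (g : Matrix (Bits n) (Bits n) ℂ) * pauliString s *
      star (g : Matrix (Bits n) (Bits n) ℂ) = pauliString t := by
  set P := pauliString s with hP
  set Q := pauliString t with hQ
  have hPQ : P * Q = -(Q * P) := by rw [hP, hQ, pauliString_mul_comm, h]; simp
  have hPP : P * P = 1 := pauliString_mul_self s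
  have hQQ : Q * Q = 1 := pauliString_mul_self t
  have hz : ((1 + Complex.I) / 2) * star ((1 + Complex.I) / 2) = (2⁻¹ : ℂ) := by
    rw [Complex.star_def, map_div₀]
    simp only [map_add, map_one, Complex.conj_I, map_ofNat]
    ring_nf
    rw [Complex.I_sq]; norm_num
  have hst : star (((1 + Complex.I) / 2) • (P + Q)) = star ((1 + Complex.I) / 2) • (P + Q) := by
    rw [star_smul, star_add, hP, hQ, star_pauliString, star_pauliString]
  have hconj (R : Matrix (Bits n) (Bits n) ℂ) : (((1 + Complex.I) / 2) • (P + Q)) * R *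
      star (((1 + Complex.I) / 2) • (P + Q)) = (2⁻¹ : ℂ) • ((P + Q) * R * (P + Q)) := by
    rw [hst, smul_mul_assoc, smul_mul_smul_comm, hz]
  have half (R : Matrix (Bits n) (Bits n) ℂ) : (2⁻¹ : ℂ) • (R + R) = R := by
    rw [← two_smul ℂ R, smul_smul]; norm_num
  have hsq : (P + Q) * (P + Q) = 1 + 1 := by
    rw [add_mul, mul_add, mul_add, hPP, hQQ, hPQ]; abel
  have hU : ((1 + Complex.I) / 2) • (P + Q) ∈ Matrix.unitaryGroup (Bits n) ℂ := by
    rw [Matrix.mem_unitaryGroup_iff]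
    have := hconj 1
    rwa [mul_one, mul_one, hsq, half] at this
  have hPm : P ∈ pauliGroup n := pauliString_mem_pauliGroup s
  have hQm : Q ∈ pauliGroup n := pauliString_mem_pauliGroup t
  have h2 : (2⁻¹ : ℂ) ∈ gaussianDyadic := Subring.subset_closure (by simp)
  have hI : Complex.I ∈ gaussianDyadic := Subring.subset_closure (by simp)
  refine ⟨⟨_, hU⟩, ⟨fun x y => ?_, fun R hR => ?_⟩, ?_⟩
  · simp only [Matrix.smul_apply, Matrix.add_apply, smul_eq_mul, div_eq_mul_inv]
    exact Subring.mul_mem _ (Subring.mul_mem _ (Subring.add_mem _ (one_mem _) hI) h2)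
      (Subring.add_mem _ (pauliString_apply_mem s x y) (pauliString_apply_mem t x y))
  · change (((1 + Complex.I) / 2) • (P + Q)) * R *
      star (((1 + Complex.I) / 2) • (P + Q)) ∈ pauliGroup n
    rw [hconj]
    have key : (P + Q) * R * (P + Q) = P * R * P + P * R * Q + Q * R * P + Q * R * Q := by
      noncomm_ring
    have e1 : P * R * P = P * (R * P) := mul_assoc _ _ _
    have e2 : P * R * Q = P * (R * Q) := mul_assoc _ _ _
    have e3 : Q * R * P = Q * (R * P) := mul_assoc _ _ _
    have e4 : Q * R * Q = Q * (R * Q) := mul_assoc _ _ _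
    rw [key, e1, e2, e3, e4]
    -- The signs with which `R` commutes past `P` and `Q` decide the outcome: the four terms always
    -- collapse to twice one of ±R, ±QPR.
    rcases pauliGroup_commute_or s hR with h1 | h1 <;>
    rcases pauliGroup_commute_or t hR with h2 | h2 <;>
    simp only [← hP, ← hQ] at h1 h2 <;>
    simp only [h1, h2, mul_neg, ← mul_assoc, hPP, hQQ, hPQ, neg_mul, one_mul, neg_neg]
    · rw [show R + -(Q * P * R) + Q * P * R + R = R + R by abel, half]
      exact hR
    · rw [show R + Q * P * R + Q * P * R + -R = Q * P * R + Q * P * R by abel, half]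
      exact pauliGroup_mul (pauliGroup_mul hQm hPm) hR
    · rw [show -R + -(Q * P * R) + -(Q * P * R) + R = -(Q * P * R) + -(Q * P * R) by abel, half]
      exact pauliGroup_neg (pauliGroup_mul (pauliGroup_mul hQm hPm) hR)
    · rw [show -R + Q * P * R + -(Q * P * R) + -R = -R + -R by abel, half]
      exact pauliGroup_neg hR
  · change (((1 + Complex.I) / 2) • (P + Q)) * P * star (((1 + Complex.I) / 2) • (P + Q)) = Q
    rw [hconj]
    have : (P + Q) * P * (P + Q) = Q + Q := by
      have e : (P + Q) * P * (P + Q) = P * P * P + P * P * Q + Q * (P * P) + Q * (P * Q) := by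
        noncomm_ring
      rw [e, hPP, hPQ, mul_neg, ← mul_assoc, hQQ]
      rw [one_mul, mul_one, one_mul]
      abel
    rw [this, half]

/-- If the supports share a site, a nontrivial Pauli matrix different from both entries there
suffices. Otherwise one site from each support is used, where the other string is trivial. -/
lemma exists_anticommute {s t : Fin n → Fin 4} (hs : s ≠ 0) (ht : t ≠ 0) :
    ∃ r, stringSign s r = -1 ∧ stringSign r t = -1 := by
  have two : ∀ a b : Fin 4, a ≠ 0 → b ≠ 0 → ∃ c : Fin 4, c ≠ 0 ∧ c ≠ a ∧ c ≠ b := by decide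
  have val {a b : Fin 4} (ha : a ≠ 0) (hb : b ≠ 0) (h : a ≠ b) : pauliSign a b = -1 := by
    simp [pauliSign, ha, hb, h]
  by_cases hc : ∃ j, s j ≠ 0 ∧ t j ≠ 0
  · obtain ⟨j, hsj, htj⟩ := hc
    obtain ⟨c, hc0, hcs, hct⟩ := two _ _ hsj htj
    refine ⟨fun l => if l = j then c else 0, ?_, ?_⟩
    · rw [stringSign, Finset.prod_eq_single j (fun l _ hl => by simp [hl, pauliSign]) (by simp)]
      simpa using val hsj hc0 hcs.symm
    · rw [stringSign, Finset.prod_eq_single j (fun l _ hl => by simp [hl, pauliSign]) (by simp)]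
      simpa using val hc0 htj hct
  · push Not at hc
    obtain ⟨i, hi⟩ := Function.ne_iff.mp hs
    obtain ⟨j, hj⟩ := Function.ne_iff.mp ht
    have hti : t i = 0 := hc i hi
    have hsj : s j = 0 := by
      by_contra h
      exact hj (hc j h)
    have hij : i ≠ j := fun h => hi (by rw [h]; exact hsj)
    obtain ⟨a, ha0, has, -⟩ := two _ _ hi hi
    obtain ⟨b, hb0, hbt, -⟩ := two _ _ hj hj
    refine ⟨fun l => if l = i then a else if l = j then b else 0, ?_, ?_⟩
    · rw [stringSign, Finset.prod_eq_single i (fun l _ hl => ?_) (by simp)]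
      · simpa using val hi ha0 has.symm
      · by_cases h : l = j
        · simp [h, hsj, pauliSign]
        · simp [h, hl, pauliSign]
    · rw [stringSign, Finset.prod_eq_single j (fun l _ hl => ?_) (by simp)]
      · simpa [hij.symm] using val hb0 hj hbt
      · by_cases h : l = i
        · simp [h, hti, pauliSign]
        · simp [h, hl, pauliSign]

/-- The Clifford group acts transitively on the nontrivial Pauli strings. -/
lemma exists_clifford_conj {s t : Fin n → Fin 4} (hs : s ≠ 0) (ht : t ≠ 0) :
    ∃ g ∈ cliffordGroup n, (g : Matrix (Bits n) (Bits n) ℂ) * pauliString s *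
      star (g : Matrix (Bits n) (Bits n) ℂ) = pauliString t := by
  -- Anticommuting strings are conjugate by a single explicit unitary; the general case passes
  -- through a string anticommuting with both.
  obtain ⟨r, hsr, hrt⟩ := exists_anticommute hs ht
  obtain ⟨g, hg, e⟩ := exists_clifford_of_anticommute hsr
  obtain ⟨g', hg', e'⟩ := exists_clifford_of_anticommute hrt
  refine ⟨g' * g, cliffordGroup_mul hg' hg, ?_⟩
  rw [Matrix.UnitaryGroup.mul_val, star_mul, ← e', ← e]
  simp only [mul_assoc]

lemma exists_int_of_mem_gaussianDyadic {z : ℂ} (hz : z ∈ gaussianDyadic) :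
    ∃ (k : ℕ) (a b : ℤ), z * 2 ^ k = a + b * Complex.I := by
  induction hz using Subring.closure_induction with
  | mem x hx =>
    rcases hx with rfl | rfl
    · exact ⟨1, 1, 0, by norm_num⟩
    · exact ⟨0, 0, 1, by norm_num⟩
  | zero => exact ⟨0, 0, 0, by norm_num⟩
  | one => exact ⟨0, 1, 0, by norm_num⟩
  | add x y _ _ hx hy =>
    obtain ⟨k, a, b, h⟩ := hx
    obtain ⟨l, c, d, h'⟩ := hy
    refine ⟨k + l, a * 2 ^ l + c * 2 ^ k, b * 2 ^ l + d * 2 ^ k, ?_⟩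
    push_cast
    rw [pow_add]
    linear_combination 2 ^ l * h + 2 ^ k * h'
  | neg x _ hx =>
    obtain ⟨k, a, b, h⟩ := hx
    exact ⟨k, -a, -b, by push_cast; linear_combination -h⟩
  | mul x y _ _ hx hy =>
    obtain ⟨k, a, b, h⟩ := hx
    obtain ⟨l, c, d, h'⟩ := hy
    refine ⟨k + l, a * c - b * d, a * d + b * c, ?_⟩
    push_cast
    rw [pow_add]
    linear_combination y * 2 ^ l * h + (a + b * Complex.I) * h' + b * d * Complex.I_sq

lemma star_mem_gaussianDyadic {z : ℂ} (hz : z ∈ gaussianDyadic) : star z ∈ gaussianDyadic := by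
  have h2 : (2⁻¹ : ℂ) ∈ gaussianDyadic := Subring.subset_closure (by simp)
  have hI : Complex.I ∈ gaussianDyadic := Subring.subset_closure (by simp)
  induction hz using Subring.closure_induction with
  | mem x hx =>
    rcases hx with rfl | rfl
    · simpa using h2
    · simpa using hI
  | zero => simp
  | one => simp
  | add x y _ _ hx hy => rw [star_add]; exact Subring.add_mem _ hx hy
  | neg x _ hx => rw [star_neg]; exact Subring.neg_mem _ hx
  | mul x y _ _ hx hy => rw [star_mul']; exact Subring.mul_mem _ hx hy

/-- Descent: squares are 0 or 1 mod 4, so for a positive exponent both integers are even and can be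
halved. -/
lemma mul_eq_zero_of_sq_add_sq_eq_four_pow (k : ℕ) (a b : ℤ) (h : a ^ 2 + b ^ 2 = 4 ^ k) :
    a * b = 0 := by
  induction k generalizing a b with
  | zero =>
    by_contra hab
    have ha : a ≠ 0 := left_ne_zero_of_mul hab
    have hb : b ≠ 0 := right_ne_zero_of_mul hab
    have := sq_pos_of_ne_zero ha
    have := sq_pos_of_ne_zero hb
    simp at h
    omega
  | succ k ih =>
    rw [pow_succ 4 k] at h
    rcases Int.even_or_odd' a with ⟨c, rfl | rfl⟩ <;> rcases Int.even_or_odd' b with ⟨d, rfl | rfl⟩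
    · have := ih c d (by linarith)
      rw [mul_mul_mul_comm, this, mul_zero]
    all_goals
      ring_nf at h
      omega

/-- The elements of `ℤ[1/2, i]` of modulus one are the powers of `i`. -/
lemma mem_of_mem_gaussianDyadic {z : ℂ} (hz : z ∈ gaussianDyadic) (h1 : ‖z‖ = 1) :
    z ∈ ({1, -1, Complex.I, -Complex.I} : Set ℂ) := by
  obtain ⟨k, a, b, h⟩ := exists_int_of_mem_gaussianDyadic hz
  have hab : a ^ 2 + b ^ 2 = 4 ^ k := by
    have e := congrArg Complex.normSq h
    rw [map_mul, Complex.normSq_eq_norm_sq z, h1, map_pow, Complex.normSq_apply,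
      Complex.normSq_apply] at e
    simp at e
    norm_num at e
    have : ((a ^ 2 + b ^ 2 : ℤ) : ℝ) = ((4 ^ k : ℤ) : ℝ) := by push_cast; rw [e]; ring
    exact_mod_cast this
  have h4 : ((2 : ℂ) ^ k) ^ 2 ≠ 0 := by simp
  have e4 : ((a : ℂ) ^ 2 + b ^ 2) = (2 ^ k) ^ 2 := by
    rw [← pow_mul, mul_comm k 2, pow_mul]; norm_num; exact_mod_cast hab
  have hz4 : z ^ 2 = 1 ∨ z ^ 2 = -1 := by
    rcases mul_eq_zero.mp (mul_eq_zero_of_sq_add_sq_eq_four_pow k a b hab) with rfl | rfl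
    · right
      refine mul_right_cancel₀ h4 ?_
      rw [← mul_pow, h, ← e4]
      push_cast
      linear_combination (b : ℂ) ^ 2 * Complex.I_sq
    · left
      refine mul_right_cancel₀ h4 ?_
      rw [← mul_pow, h, ← e4]; simp
  rcases hz4 with e | e
  · rcases sq_eq_one_iff.mp e with h | h <;> simp [h]
  · have : (z - Complex.I) * (z + Complex.I) = 0 := by
      ring_nf; rw [e, Complex.I_sq]; ring
    rcases mul_eq_zero.mp this with h | h
    · simp [sub_eq_zero.mp h]
    · simp [eq_neg_of_add_eq_zero_left h]

open scoped Matrix.Norms.Frobenius in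
/-- A matrix that commutes with all Pauli strings is scalar. -/
lemma exists_smul_one_of_commute (V : Matrix (Bits n) (Bits n) ℂ)
    (hV : ∀ s, V * pauliString s = pauliString s * V) : ∃ c : ℂ, V = c • 1 := by
  refine ⟨Matrix.trace V / 2 ^ n, ?_⟩
  rw [← sub_eq_zero, ← norm_eq_zero, ← sq_eq_zero_iff]
  have h := sum_norm_sq_trace_pauliString_mul (V - (Matrix.trace V / 2 ^ n) • 1)
  rw [Finset.sum_eq_zero] at h
  · exact (mul_eq_zero.mp h.symm).resolve_left (by positivity)
  intro s _
  rw [sq_eq_zero_iff, norm_eq_zero, mul_sub, Matrix.trace_sub, mul_smul_comm, Matrix.trace_smul]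
  have hts := trace_pauliString_mul s 0
  rw [pauliString_zero] at hts
  rw [hts]
  split_ifs with h0
  · rw [h0, pauliString_zero]; simp
  -- Conjugation by an anticommuting string fixes `V` and flips the sign of `pauliString s`, so this
  -- coefficient equals its negative.
  · obtain ⟨r, hr, -⟩ := exists_anticommute h0 h0
    have e : Matrix.trace (pauliString s * V) = -Matrix.trace (pauliString s * V) := by
      calc _ = Matrix.trace (pauliString s * pauliString r * (pauliString r * V)) := by
            rw [mul_assoc, ← mul_assoc (pauliString r), pauliString_mul_self, one_mul]
        _ = -Matrix.trace (pauliString r * (pauliString s * V * pauliString r)) := by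
            rw [pauliString_mul_comm, hr, ← hV]
            simp [mul_assoc]
        _ = _ := by
            rw [Matrix.trace_mul_comm, mul_assoc, pauliString_mul_self, mul_one]
    simpa using self_eq_neg.mp e

/-- The conjugation action on Pauli strings takes finitely many values and determines the unitary up
to a scalar. That scalar has modulus one and lies in ℤ[1/2, i], which leaves four choices. -/
lemma cliffordGroup_finite : (cliffordGroup n).Finite := by
  let f : Matrix.unitaryGroup (Bits n) ℂ → (Fin n → Fin 4) → Matrix (Bits n) (Bits n) ℂ :=
    fun U s => (U : Matrix (Bits n) (Bits n) ℂ) * pauliString s *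
      star (U : Matrix (Bits n) (Bits n) ℂ)
  refine Set.Finite.of_finite_fibers f ?_ ?_
  · refine (Set.Finite.pi' fun _ : Fin n → Fin 4 => pauliGroup_finite).subset ?_
    rintro _ ⟨U, hU, rfl⟩ s
    exact hU.2 _ (pauliString_mem_pauliGroup s)
  · rintro _ ⟨U₀, hU₀, rfl⟩
    have hfin : ((fun c : ℂ => c • (U₀ : Matrix (Bits n) (Bits n) ℂ)) ''
        {1, -1, Complex.I, -Complex.I}).Finite := Set.Finite.image _ (by simp)
    refine (hfin.preimage Subtype.val_injective.injOn).subset ?_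
    rintro U ⟨hU, hf⟩
    set A : Matrix (Bits n) (Bits n) ℂ := (U₀ : Matrix (Bits n) (Bits n) ℂ) with hA
    set B : Matrix (Bits n) (Bits n) ℂ := (U : Matrix (Bits n) (Bits n) ℂ) with hB
    have hA1 : star A * A = 1 := Matrix.mem_unitaryGroup_iff'.mp U₀.2
    have hA2 : A * star A = 1 := Matrix.mem_unitaryGroup_iff.mp U₀.2
    have hB1 : star B * B = 1 := Matrix.mem_unitaryGroup_iff'.mp U.2
    obtain ⟨c, hc⟩ := exists_smul_one_of_commute (star A * B) fun s => by
      have e : B * pauliString s * star B = A * pauliString s * star A := congrFun hf s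
      calc star A * B * pauliString s = star A * (B * pauliString s * star B) * B := by
            simp only [mul_assoc, hB1, mul_one]
        _ = (star A * A) * pauliString s * (star A * B) := by rw [e]; simp only [mul_assoc]
        _ = _ := by rw [hA1, one_mul]
    have hBc : B = c • A := by
      rw [← one_mul B, ← hA2, mul_assoc, hc]; simp
    have hcm : c ∈ gaussianDyadic := by
      have : c = (star A * B) 0 0 := by rw [hc]; simp
      rw [this, Matrix.mul_apply]
      exact Subring.sum_mem _ fun z _ =>
        Subring.mul_mem _ (star_mem_gaussianDyadic (hU₀.1 z 0)) (hU.1 z 0)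
    have hcn : ‖c‖ = 1 := by
      have e : star (star A * B) * (star A * B) = 1 := by
        rw [star_mul, star_star, mul_assoc, ← mul_assoc A, hA2, one_mul, hB1]
      rw [hc] at e
      have e0 := congrFun (congrFun e 0) 0
      simp only [star_smul, star_one, smul_mul_smul_comm, mul_one, Matrix.smul_apply,
        Matrix.one_apply_eq, smul_eq_mul, Complex.star_def, Complex.conj_mul'] at e0
      have e1 : ‖c‖ ^ 2 = 1 := by exact_mod_cast e0
      exact (pow_eq_one_iff_of_nonneg (norm_nonneg c) two_ne_zero).mp e1
    exact ⟨c, mem_of_mem_gaussianDyadic hcm hcn, hBc.symm⟩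

end CliffordGroup

/-! ### Cayley transform of skew-Hermitian matrices -/

section Cayley

variable {ι : Type*} [Fintype ι] [DecidableEq ι]

/-- A left kernel vector, repeated in every row, gives a matrix annihilated by right multiplication
with `1 + B`; such multiplication does not decrease the norm. -/
lemma isUnit_one_add_skew {B : Matrix ι ι ℂ} (hB : star B = -B) : IsUnit (1 + B) := by
  rw [Matrix.isUnit_iff_isUnit_det, isUnit_iff_ne_zero]
  intro h
  obtain ⟨v, hv0, hv⟩ := Matrix.exists_vecMul_eq_zero_iff.mpr h
  have h0 : (Matrix.of fun _ : ι => v) * (1 + B) = 0 := by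
    ext x y
    exact congrFun hv y
  have h1 := frobenius_le_mul_one_add_skew (Matrix.of fun _ : ι => v) hB
  rw [h0] at h1
  refine hv0 ?_
  open scoped Matrix.Norms.Frobenius in
  have h2 : (Matrix.of fun _ : ι => v) = 0 := norm_le_zero_iff.mp (h1.trans_eq norm_zero)
  obtain ⟨x, -⟩ := Function.ne_iff.mp hv0
  exact congrFun h2 x

lemma star_half_smul {B : Matrix ι ι ℂ} (hB : star B = -B) :
    star ((2⁻¹ : ℂ) • B) = -((2⁻¹ : ℂ) • B) := by
  rw [star_smul, hB]; simp

/-- The Cayley transform of a skew-Hermitian matrix. -/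
def cayley (B : Matrix ι ι ℂ) (hB : star B = -B) : Matrix.unitaryGroup ι ℂ :=
  ⟨(1 - (2⁻¹ : ℂ) • B) * (1 + (2⁻¹ : ℂ) • B)⁻¹, by
    have hB2 := star_half_smul hB
    set T := (2⁻¹ : ℂ) • B
    have hu := isUnit_one_add_skew hB2
    have hdet := (Matrix.isUnit_iff_isUnit_det _).mp hu
    set W := (1 - T) * (1 + T)⁻¹ with hW
    have hWT : W * (1 + T) = 1 - T := by
      rw [hW, mul_assoc, Matrix.nonsing_inv_mul _ hdet, mul_one]
    clear_value W T
    rw [Matrix.mem_unitaryGroup_iff']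
    have hs : star (1 + T) = 1 - T := by rw [star_add, star_one, hB2, sub_eq_add_neg]
    refine hu.star.mul_left_cancel (hu.mul_right_cancel ?_)
    calc star (1 + T) * (star W * W) * (1 + T) = star (W * (1 + T)) * (W * (1 + T)) := by
          rw [star_mul]; simp only [mul_assoc]
      _ = star (1 + T) * 1 * (1 + T) := by
          rw [hWT, ← hs, star_star, hs, mul_one]
          noncomm_ring⟩

lemma cayley_mul (B : Matrix ι ι ℂ) (hB : star B = -B) :
    (cayley B hB : Matrix ι ι ℂ) * (1 + (2⁻¹ : ℂ) • B) = 1 - (2⁻¹ : ℂ) • B := by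
  have hdet := (Matrix.isUnit_iff_isUnit_det _).mp (isUnit_one_add_skew (star_half_smul hB))
  rw [cayley, mul_assoc, Matrix.nonsing_inv_mul _ hdet, mul_one]

lemma continuous_cayley {X : Type*} [TopologicalSpace X] {f : X → Matrix ι ι ℂ}
    (hf : Continuous f) (hs : ∀ x, star (f x) = -f x) :
    Continuous fun x => cayley (f x) (hs x) := by
  refine Continuous.subtype_mk ?_ _
  have h2 : Continuous fun x => (2⁻¹ : ℂ) • f x :=
    Continuous.const_smul hf (2⁻¹ : ℂ)
  refine (continuous_const.sub h2).matrix_mul ?_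
  have h3 : Continuous fun x => 1 + (2⁻¹ : ℂ) • f x := continuous_const.add h2
  simp only [Matrix.inv_def, Ring.inverse_eq_inv']
  refine Continuous.smul (h3.matrix_det.inv₀ fun x => ?_) h3.matrix_adjugate
  exact ((Matrix.isUnit_iff_isUnit_det _).mp (isUnit_one_add_skew (star_half_smul (hs x)))).ne_zero

end Cayley

/-! ### Embedding of one-qubit matrices -/

section FirstQubit

variable {n : ℕ}

/-- The matrix `M ⊗ 𝟙_{n-1}`. -/
def firstQubit (n : ℕ) (M : Matrix (Fin 2) (Fin 2) ℂ) : Matrix (Bits n) (Bits n) ℂ :=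
  tensor fun j : Fin n => if (j : ℕ) = 0 then M else 1

lemma onFirstQubit_val (U : Matrix.unitaryGroup (Fin 2) ℂ) :
    (onFirstQubit n U : Matrix (Bits n) (Bits n) ℂ) = firstQubit n U := rfl

lemma firstQubit_mul (A B : Matrix (Fin 2) (Fin 2) ℂ) :
    firstQubit n (A * B) = firstQubit n A * firstQubit n B := by
  rw [firstQubit, firstQubit, firstQubit, tensor_mul]
  congr 1; funext j
  split_ifs <;> simp

lemma firstQubit_one : firstQubit n 1 = 1 := by
  simp [firstQubit, tensor_one]

lemma onFirstQubit_mul (U V : Matrix.unitaryGroup (Fin 2) ℂ) :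
    onFirstQubit n (U * V) = onFirstQubit n U * onFirstQubit n V :=
  Subtype.ext (firstQubit_mul _ _)

lemma continuous_onFirstQubit : Continuous (onFirstQubit n) := by
  refine Continuous.subtype_mk ?_ _
  refine continuous_pi fun x => continuous_pi fun y => ?_
  simp only [tensor, Matrix.of_apply]
  refine continuous_finsetProd _ fun j _ => ?_
  split_ifs
  · exact continuous_entry _ _
  · exact continuous_const

lemma firstQubit_apply (hn : 1 ≤ n) (M : Matrix (Fin 2) (Fin 2) ℂ) (x y : Bits n) :
    firstQubit n M x y = M (x ⟨0, hn⟩) (y ⟨0, hn⟩) *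
      ∏ j ∈ Finset.univ.erase (⟨0, hn⟩ : Fin n), (1 : Matrix (Fin 2) (Fin 2) ℂ) (x j) (y j) := by
  rw [firstQubit, tensor, Matrix.of_apply, ← Finset.mul_prod_erase _ _ (Finset.mem_univ ⟨0, hn⟩)]
  congr 1
  refine Finset.prod_congr rfl fun j hj => ?_
  rw [if_neg fun h => Finset.ne_of_mem_erase hj (Fin.ext h)]

/-- `M ↦ M ⊗ 𝟙_{n-1}` as a linear map. -/
def firstQubitLinear (hn : 1 ≤ n) :
    Matrix (Fin 2) (Fin 2) ℂ →ₗ[ℂ] Matrix (Bits n) (Bits n) ℂ where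
  toFun := firstQubit n
  map_add' A B := by
    ext x y
    simp only [firstQubit_apply hn, Matrix.add_apply, add_mul]
  map_smul' c A := by
    ext x y
    simp only [firstQubit_apply hn, Matrix.smul_apply, smul_eq_mul, RingHom.id_apply, mul_assoc]

lemma firstQubit_add (hn : 1 ≤ n) (A B : Matrix (Fin 2) (Fin 2) ℂ) :
    firstQubit n (A + B) = firstQubit n A + firstQubit n B := (firstQubitLinear hn).map_add A B

lemma firstQubit_sub (hn : 1 ≤ n) (A B : Matrix (Fin 2) (Fin 2) ℂ) :
    firstQubit n (A - B) = firstQubit n A - firstQubit n B := (firstQubitLinear hn).map_sub A B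

lemma firstQubit_smul (hn : 1 ≤ n) (c : ℂ) (A : Matrix (Fin 2) (Fin 2) ℂ) :
    firstQubit n (c • A) = c • firstQubit n A := (firstQubitLinear hn).map_smul c A

/-- The label of the Pauli string `P ⊗ 𝟙_{n-1}`. -/
def firstLabel (n : ℕ) (a : Fin 4) : Fin n → Fin 4 := fun j => if (j : ℕ) = 0 then a else 0

lemma firstQubit_pauli (a : Fin 4) : firstQubit n (pauli a) = pauliString (firstLabel n a) := by
  rw [firstQubit, pauliString]
  congr 1; funext j
  unfold firstLabel
  split_ifs
  · rfl
  · simp [pauli]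

lemma firstLabel_injective (hn : 1 ≤ n) : Function.Injective (firstLabel n) := fun a b h => by
  simpa [firstLabel] using congrFun h ⟨0, hn⟩

lemma firstLabel_zero : firstLabel n 0 = 0 := by
  funext j; simp [firstLabel]

end FirstQubit

/-! ### Cancelling the first-qubit part of a unitary near the identity -/

section Correction

variable {n : ℕ}

/-- The coefficient of `P ⊗ 𝟙_{n-1}` in the skew-Hermitian part of `K`. -/
def skewCoeff (K : Matrix (Bits n) (Bits n) ℂ) (a : Fin 4) : ℂ :=
  (((Matrix.trace (pauliString (firstLabel n a) * K)).im / 2 ^ n : ℝ) : ℂ) * Complex.I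

/-- The projection of the skew-Hermitian part of `K` to the first qubit. -/
def skewPart (K : Matrix (Bits n) (Bits n) ℂ) : Matrix (Fin 2) (Fin 2) ℂ :=
  ∑ a, skewCoeff K a • pauli a

lemma star_skewCoeff (K : Matrix (Bits n) (Bits n) ℂ) (a : Fin 4) :
    star (skewCoeff K a) = -skewCoeff K a := by
  simp only [skewCoeff, star_mul', Complex.star_def, Complex.conj_ofReal, Complex.conj_I, mul_neg]

lemma star_skewPart (K : Matrix (Bits n) (Bits n) ℂ) : star (skewPart K) = -skewPart K := by
  simp only [skewPart, star_sum, star_smul, star_pauli, star_skewCoeff, neg_smul,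
    Finset.sum_neg_distrib]

lemma firstQubit_skewPart (hn : 1 ≤ n) (K : Matrix (Bits n) (Bits n) ℂ) :
    firstQubit n (skewPart K) = ∑ a, skewCoeff K a • pauliString (firstLabel n a) := by
  change firstQubitLinear hn _ = _
  rw [skewPart, map_sum]
  simp only [map_smul]
  exact Finset.sum_congr rfl fun a _ => congrArg _ (firstQubit_pauli a)

lemma star_firstQubit_skewPart (hn : 1 ≤ n) (K : Matrix (Bits n) (Bits n) ℂ) :
    star (firstQubit n (skewPart K)) = -firstQubit n (skewPart K) := by
  simp only [firstQubit_skewPart hn, star_sum, star_smul, star_pauliString, star_skewCoeff,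
    neg_smul, Finset.sum_neg_distrib]

/-- The unitary on the first qubit that corrects for the part of `E` on the first qubit. -/
def correction (E : Matrix.unitaryGroup (Bits n) ℂ) : Matrix.unitaryGroup (Fin 2) ℂ :=
  cayley (skewPart ((E : Matrix (Bits n) (Bits n) ℂ) - 1)) (star_skewPart _)

/-- The Cayley transform is defined and continuous for every skew-Hermitian argument, so no branch
has to be chosen. This later makes the coupling measurable. -/
lemma continuous_correction : Continuous (correction (n := n)) := by
  refine continuous_cayley (f := fun E : Matrix.unitaryGroup (Bits n) ℂ =>
    skewPart ((E : Matrix (Bits n) (Bits n) ℂ) - 1)) ?_ _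
  refine continuous_finsetSum _ fun a _ => ?_
  refine Continuous.smul (f := fun E : Matrix.unitaryGroup (Bits n) ℂ =>
    skewCoeff ((E : Matrix (Bits n) (Bits n) ℂ) - 1) a) (g := fun _ => pauli a) ?_ continuous_const
  have h : Continuous fun E : Matrix.unitaryGroup (Bits n) ℂ =>
      Matrix.trace (pauliString (firstLabel n a) * ((E : Matrix (Bits n) (Bits n) ℂ) - 1)) :=
    Continuous.matrix_trace (Continuous.matrix_mul (A := fun _ => pauliString (firstLabel n a))
      continuous_const (continuous_subtype_val.sub continuous_const))
  exact (Complex.continuous_ofReal.comp ((Complex.continuous_im.comp h).div_const _)).mul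
    continuous_const

lemma onFirstQubit_cayley_mul (hn : 1 ≤ n) (B : Matrix (Fin 2) (Fin 2) ℂ) (hB : star B = -B) :
    (onFirstQubit n (cayley B hB) : Matrix (Bits n) (Bits n) ℂ) *
      (1 + (2⁻¹ : ℂ) • firstQubit n B) = 1 - (2⁻¹ : ℂ) • firstQubit n B := by
  rw [onFirstQubit_val, ← firstQubit_one, ← firstQubit_smul hn, ← firstQubit_add hn,
    ← firstQubit_sub hn, ← firstQubit_mul, cayley_mul]

open scoped Matrix.Norms.Frobenius

/-- The squared norm of the projection of `K` to the first qubit. -/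
def firstQubitWeight (K : Matrix (Bits n) (Bits n) ℂ) : ℝ :=
  (∑ a, ‖Matrix.trace (pauliString (firstLabel n a) * K)‖ ^ 2) / 2 ^ n

lemma trace_sum_smul_pauliString (c : Fin 4 → ℂ) (A : Matrix (Bits n) (Bits n) ℂ) :
    Matrix.trace (A * ∑ a, c a • pauliString (firstLabel n a)) =
      ∑ a, c a * Matrix.trace (pauliString (firstLabel n a) * A) := by
  rw [Finset.mul_sum, Matrix.trace_sum]
  refine Finset.sum_congr rfl fun a _ => ?_
  rw [mul_smul_comm, Matrix.trace_smul, Matrix.trace_mul_comm, smul_eq_mul]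

lemma frobenius_firstQubit_skewPart_sq (hn : 1 ≤ n) (K : Matrix (Bits n) (Bits n) ℂ) :
    ‖firstQubit n (skewPart K)‖ ^ 2 =
      (∑ a, (Matrix.trace (pauliString (firstLabel n a) * K)).im ^ 2) / 2 ^ n := by
  rw [frobenius_sq_eq_trace, star_firstQubit_skewPart hn, firstQubit_skewPart hn,
    trace_sum_smul_pauliString]
  simp only [mul_neg, trace_sum_smul_pauliString, trace_pauliString_mul, Matrix.trace_neg,
    (firstLabel_injective hn).eq_iff]
  rw [Finset.sum_div, Complex.re_sum]
  refine Finset.sum_congr rfl fun a _ => ?_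
  simp only [mul_ite, mul_zero, Finset.sum_ite_eq', Finset.mem_univ, if_true]
  have e : -(skewCoeff K a * (skewCoeff K a * 2 ^ n)) =
      (((Matrix.trace (pauliString (firstLabel n a) * K)).im ^ 2 / 2 ^ n : ℝ) : ℂ) := by
    rw [skewCoeff]
    have : (2 : ℂ) ^ n ≠ 0 := by simp
    push_cast
    field_simp
    rw [Complex.I_sq]
    ring
  rw [e, Complex.ofReal_re]

/-- Pythagoras: the subtracted matrix is the orthogonal projection of `K`, for the real inner
product Re tr(A* B), onto the real span of the i P ⊗ 𝟙. -/
lemma frobenius_sub_firstQubit_skewPart_sq (hn : 1 ≤ n) (K : Matrix (Bits n) (Bits n) ℂ) :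
    ‖K - firstQubit n (skewPart K)‖ ^ 2 = ‖K‖ ^ 2 - ‖firstQubit n (skewPart K)‖ ^ 2 := by
  rw [frobenius_sub_sq]
  have : (Matrix.trace (star K * firstQubit n (skewPart K))).re =
      ‖firstQubit n (skewPart K)‖ ^ 2 := by
    rw [frobenius_firstQubit_skewPart_sq hn, firstQubit_skewPart hn, trace_sum_smul_pauliString,
      Complex.re_sum, Finset.sum_div]
    refine Finset.sum_congr rfl fun a _ => ?_
    have e : Matrix.trace (pauliString (firstLabel n a) * star K) =
        star (Matrix.trace (pauliString (firstLabel n a) * K)) := by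
      rw [← Matrix.trace_conjTranspose, ← Matrix.star_eq_conjTranspose, star_mul, star_pauliString,
        Matrix.trace_mul_comm]
    rw [e, skewCoeff, Complex.mul_re, Complex.re_ofReal_mul, Complex.im_ofReal_mul, Complex.I_re,
      Complex.I_im, Complex.star_def, Complex.conj_re, Complex.conj_im]
    ring
  rw [this]
  ring

/-- Unitarity gives K + K* = -K* K for K = E - 1, so the Hermitian part of K is quadratically small.
-/
lemma abs_re_trace_pauliString_mul_le (E : Matrix.unitaryGroup (Bits n) ℂ) (s : Fin n → Fin 4) :
    |(Matrix.trace (pauliString s * ((E : Matrix (Bits n) (Bits n) ℂ) - 1))).re| ≤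
      ‖(E : Matrix (Bits n) (Bits n) ℂ) - 1‖ ^ 2 / 2 := by
  set K := (E : Matrix (Bits n) (Bits n) ℂ) - 1 with hK
  have hs : K + star K = -(star K * K) := by
    have h := Matrix.mem_unitaryGroup_iff'.mp E.2
    rw [hK, star_sub, star_one, sub_mul, mul_sub, h]
    noncomm_ring
  have e : (Matrix.trace (pauliString s * star K)).re = (Matrix.trace (pauliString s * K)).re := by
    have := re_trace_star_mul_comm K (pauliString s)
    rw [star_pauliString] at this
    rw [this, Matrix.trace_mul_comm]
  have h2 : 2 * (Matrix.trace (pauliString s * K)).re =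
      -(Matrix.trace (star (K * pauliString s) * K)).re := by
    rw [star_mul, star_pauliString, mul_assoc, ← Complex.neg_re, ← Matrix.trace_neg, ← mul_neg,
      ← hs, mul_add, Matrix.trace_add, Complex.add_re, e]
    ring
  have h3 := abs_re_trace_star_mul_le (K * pauliString s) K
  rw [frobenius_mul_unitary _ (pauliString_mem_unitaryGroup s), ← abs_neg, ← h2, abs_mul] at h3
  norm_num at h3
  linarith

lemma frobeniusDist_correction_aux (hn : 1 ≤ n) (E : Matrix.unitaryGroup (Bits n) ℂ) :
    frobeniusDist 1 (E * onFirstQubit n (correction E)) ≤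
      ‖(E : Matrix (Bits n) (Bits n) ℂ) - 1 -
        firstQubit n (skewPart ((E : Matrix (Bits n) (Bits n) ℂ) - 1))‖ +
        frobeniusDist 1 E ^ 2 / 2 := by
  set K := (E : Matrix (Bits n) (Bits n) ℂ) - 1 with hK
  set B := firstQubit n (skewPart K) with hB
  have h := frobenius_cayley_le K B _ (star_firstQubit_skewPart hn K) 
    (onFirstQubit_cayley_mul hn _ (star_skewPart K))
  have hBK : ‖B‖ ≤ ‖K‖ := by
    have := frobenius_sub_firstQubit_skewPart_sq hn K
    refine (abs_le_of_sq_le_sq' ?_ (norm_nonneg _)).2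
    nlinarith [sq_nonneg ‖K - firstQubit n (skewPart K)‖]
  rw [frobeniusDist_comm, frobeniusDist_comm 1 E, frobeniusDist_eq, frobeniusDist_eq,
    Matrix.UnitaryGroup.mul_val, Matrix.UnitaryGroup.one_val, ← hK]
  have e : (E : Matrix (Bits n) (Bits n) ℂ) = 1 + K := by rw [hK]; abel
  rw [e]
  refine h.trans ?_
  nlinarith [norm_nonneg K, norm_nonneg B]

/-- A crude worst-case bound, used only to keep segments short over several steps. -/
lemma frobeniusDist_correction_le (hn : 1 ≤ n) (E : Matrix.unitaryGroup (Bits n) ℂ) :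
    frobeniusDist 1 (E * onFirstQubit n (correction E)) ≤
      frobeniusDist 1 E + frobeniusDist 1 E ^ 2 / 2 := by
  refine (frobeniusDist_correction_aux hn E).trans ?_
  have h := frobenius_sub_firstQubit_skewPart_sq hn ((E : Matrix (Bits n) (Bits n) ℂ) - 1)
  gcongr
  rw [frobeniusDist_comm, frobeniusDist_eq, Matrix.UnitaryGroup.one_val]
  refine (abs_le_of_sq_le_sq' ?_ (norm_nonneg _)).2
  rw [h]
  nlinarith [sq_nonneg ‖firstQubit n (skewPart ((E : Matrix (Bits n) (Bits n) ℂ) - 1))‖]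

/-- Squaring the bound of `frobeniusDist_correction_aux`, the cross term is cubic. Replacing the
skew part's squared norm by the full first-qubit weight costs a quartic term. -/
lemma frobeniusDist_correction_sq_le (hn : 1 ≤ n) (E : Matrix.unitaryGroup (Bits n) ℂ) :
    frobeniusDist 1 (E * onFirstQubit n (correction E)) ^ 2 ≤
      frobeniusDist 1 E ^ 2 - firstQubitWeight ((E : Matrix (Bits n) (Bits n) ℂ) - 1) +
        (frobeniusDist 1 E ^ 3 + 2 * frobeniusDist 1 E ^ 4) := by
  have h := frobeniusDist_correction_aux hn E
  have h0 := frobeniusDist_nonneg 1 (E * onFirstQubit n (correction E))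
  have hu := fun s => abs_re_trace_pauliString_mul_le E s
  have e : frobeniusDist 1 E = ‖(E : Matrix (Bits n) (Bits n) ℂ) - 1‖ := by
    rw [frobeniusDist_comm, frobeniusDist_eq, Matrix.UnitaryGroup.one_val]
  rw [e] at h ⊢
  set K := (E : Matrix (Bits n) (Bits n) ℂ) - 1 with hK
  set B := firstQubit n (skewPart K) with hB
  have h1 : ‖K - B‖ ^ 2 = ‖K‖ ^ 2 - ‖B‖ ^ 2 := frobenius_sub_firstQubit_skewPart_sq hn K
  have h2 : ‖B‖ ^ 2 = _ := frobenius_firstQubit_skewPart_sq hn K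
  have hKB : ‖K - B‖ ≤ ‖K‖ := by
    refine (abs_le_of_sq_le_sq' ?_ (norm_nonneg _)).2
    nlinarith [sq_nonneg ‖B‖]
  -- The weight exceeds ‖B‖² only through the real parts of four coefficients, each at most ‖K‖²/2
  -- in absolute value.
  have hw : firstQubitWeight K ≤ ‖B‖ ^ 2 + ‖K‖ ^ 4 := by
    rw [h2, firstQubitWeight, div_add' _ _ _ (by positivity)]
    gcongr
    have hN : (1 : ℝ) ≤ 2 ^ n := one_le_pow₀ (by norm_num)
    calc ∑ a, ‖Matrix.trace (pauliString (firstLabel n a) * K)‖ ^ 2 ≤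
          ∑ a : Fin 4, ((Matrix.trace (pauliString (firstLabel n a) * K)).im ^ 2 + ‖K‖ ^ 4 / 4) :=
          Finset.sum_le_sum fun a _ => by
            rw [← Complex.normSq_eq_norm_sq, Complex.normSq_apply]
            have h3 := sq_le_sq' (abs_le.mp (hu (firstLabel n a))).1 (abs_le.mp (hu _)).2
            linarith
      _ = ∑ a : Fin 4, (Matrix.trace (pauliString (firstLabel n a) * K)).im ^ 2 + ‖K‖ ^ 4 := by
          rw [Finset.sum_add_distrib, Finset.sum_const, Finset.card_univ, Fintype.card_fin,
            nsmul_eq_mul]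
          push_cast
          ring
      _ ≤ _ := by
          gcongr
          exact le_mul_of_one_le_right (by positivity) hN
  have h3 := pow_le_pow_left₀ h0 h 2
  have h4 := mul_le_mul_of_nonneg_right hKB (sq_nonneg ‖K‖)
  have h5 : 0 ≤ ‖K‖ ^ 4 := pow_nonneg (norm_nonneg _) 4
  generalize frobeniusDist 1 (E * onFirstQubit n (correction E)) = d at *
  generalize ‖K - B‖ = x at *
  generalize ‖K‖ = y at *
  linarith

end Correction

/-! ### Haar measure on the unitary group -/

section Measures

variable {ι : Type*} [Fintype ι] [DecidableEq ι]

instance instSecondCountableUnitary : SecondCountableTopology (Matrix.unitaryGroup ι ℂ) := by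
  have : SecondCountableTopology (Matrix ι ι ℂ) :=
    inferInstanceAs (SecondCountableTopology (ι → ι → ℂ))
  exact TopologicalSpace.Subtype.secondCountableTopology _

instance instIsProbabilityMeasureHaar : IsProbabilityMeasure (haar ι) :=
  ⟨Measure.haarMeasure_self⟩

instance instIsHaarMeasureHaar : (haar ι).IsHaarMeasure :=
  inferInstanceAs (Measure.haarMeasure ⊤).IsHaarMeasure

/-- A right translate is again a Haar probability measure, and such a measure is unique. -/
instance instIsMulRightInvariantHaar : (haar ι).IsMulRightInvariant := by
  refine ⟨fun g => ?_⟩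
  have : IsProbabilityMeasure ((haar ι).map (· * g)) :=
    Measure.isProbabilityMeasure_map (measurable_mul_const g).aemeasurable
  exact Measure.isHaarMeasure_eq_of_isProbabilityMeasure _ _

lemma integrable_of_continuous {X : Type*} [TopologicalSpace X] [CompactSpace X]
    [MeasurableSpace X] [OpensMeasurableSpace X] (μ : Measure X) [IsFiniteMeasure μ] {f : X → ℝ}
    (hf : Continuous f) : Integrable f μ :=
  hf.integrable_of_hasCompactSupport (HasCompactSupport.of_compactSpace f)

end Measures

/-! ### Averaging Pauli weights over the Clifford group -/

section CliffordMeasure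

variable {n : ℕ}

instance instIsProbabilityMeasureClifford : IsProbabilityMeasure (cliffordMeasure n) :=
  ProbabilityTheory.isProbabilityMeasure_uniformOn cliffordGroup_finite ⟨1, one_mem_cliffordGroup⟩

instance instIsProbabilityMeasureHaarFirstQubit : IsProbabilityMeasure (haarFirstQubit n) :=
  Measure.isProbabilityMeasure_map continuous_onFirstQubit.measurable.aemeasurable

instance instIsProbabilityMeasureSigma : IsProbabilityMeasure (sigma n) := by
  unfold sigma; infer_instance

lemma map_mul_right_cliffordMeasure {g : Matrix.unitaryGroup (Bits n) ℂ}
    (hg : g ∈ cliffordGroup n) : (cliffordMeasure n).map (· * g) = cliffordMeasure n := by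
  have himg : (· * g) '' cliffordGroup n = cliffordGroup n := by
    refine Set.eq_of_subset_of_ncard_le ?_ ?_ cliffordGroup_finite
    · rintro _ ⟨U, hU, rfl⟩
      exact cliffordGroup_mul hU hg
    · rw [Set.ncard_image_of_injective _ (mul_left_injective g)]
  have hpre : (· * g) ⁻¹' cliffordGroup n = cliffordGroup n := by
    conv_lhs => rw [← himg]
    exact Set.preimage_image_eq _ (mul_left_injective g)
  ext t ht
  rw [Measure.map_apply (measurable_mul_const g) ht, cliffordMeasure, ProbabilityTheory.uniformOn,
    ProbabilityTheory.cond_apply cliffordGroup_finite.measurableSet,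
    ProbabilityTheory.cond_apply cliffordGroup_finite.measurableSet]
  conv_lhs => rw [← hpre, ← Set.preimage_inter]
  rw [measure_preimage_mul_right, measure_preimage_mul_right]

/-- The mean squared Pauli coefficient of a Clifford twirl of `K`. -/
def meanWeight (K : Matrix (Bits n) (Bits n) ℂ) (s : Fin n → Fin 4) : ℝ :=
  ∫ c, ‖Matrix.trace ((c : Matrix (Bits n) (Bits n) ℂ) * pauliString s *
    star (c : Matrix (Bits n) (Bits n) ℂ) * K)‖ ^ 2 ∂(cliffordMeasure n)

lemma continuous_star_val : Continuous fun c : Matrix.unitaryGroup (Bits n) ℂ =>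
    star (c : Matrix (Bits n) (Bits n) ℂ) := continuous_subtype_val.star

lemma continuous_weight (K : Matrix (Bits n) (Bits n) ℂ) (s : Fin n → Fin 4) :
    Continuous fun c : Matrix.unitaryGroup (Bits n) ℂ =>
      ‖Matrix.trace ((c : Matrix (Bits n) (Bits n) ℂ) * pauliString s *
        star (c : Matrix (Bits n) (Bits n) ℂ) * K)‖ ^ 2 := by
  have h1 : Continuous fun c : Matrix.unitaryGroup (Bits n) ℂ =>
      (c : Matrix (Bits n) (Bits n) ℂ) * pauliString s :=
    continuous_subtype_val.matrix_mul continuous_const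
  have h2 : Continuous fun c : Matrix.unitaryGroup (Bits n) ℂ =>
      (c : Matrix (Bits n) (Bits n) ℂ) * pauliString s *
        star (c : Matrix (Bits n) (Bits n) ℂ) := h1.matrix_mul continuous_star_val
  have h3 : Continuous fun c : Matrix.unitaryGroup (Bits n) ℂ =>
      (c : Matrix (Bits n) (Bits n) ℂ) * pauliString s *
        star (c : Matrix (Bits n) (Bits n) ℂ) * K := h2.matrix_mul continuous_const
  exact (h3.matrix_trace.norm).pow 2

lemma meanWeight_nonneg (K : Matrix (Bits n) (Bits n) ℂ) (s : Fin n → Fin 4) :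
    0 ≤ meanWeight K s := integral_nonneg fun _ => by positivity

/-- Replacing c by c g, with g a Clifford unitary conjugating one string to the other, preserves the
uniform measure. -/
lemma meanWeight_eq (K : Matrix (Bits n) (Bits n) ℂ) {s t : Fin n → Fin 4} (hs : s ≠ 0)
    (ht : t ≠ 0) : meanWeight K s = meanWeight K t := by
  obtain ⟨g, hg, e⟩ := exists_clifford_conj hs ht
  conv_lhs => rw [meanWeight, ← map_mul_right_cliffordMeasure hg]
  rw [integral_map (measurable_mul_const g).aemeasurable
    (continuous_weight K s).aestronglyMeasurable, meanWeight]
  refine integral_congr_ae (Filter.Eventually.of_forall fun c => ?_)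
  simp only [← e, Matrix.UnitaryGroup.mul_val, star_mul, mul_assoc]

open scoped Matrix.Norms.Frobenius in
lemma sum_meanWeight (K : Matrix (Bits n) (Bits n) ℂ) :
    ∑ s, meanWeight K s = 2 ^ n * ‖K‖ ^ 2 := by
  unfold meanWeight
  rw [← integral_finsetSum _ fun s _ => integrable_of_continuous _ (continuous_weight K s)]
  have : ∀ c : Matrix.unitaryGroup (Bits n) ℂ,
      ∑ s, ‖Matrix.trace ((c : Matrix (Bits n) (Bits n) ℂ) * pauliString s *
        star (c : Matrix (Bits n) (Bits n) ℂ) * K)‖ ^ 2 = 2 ^ n * ‖K‖ ^ 2 := fun c => by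
    have h := sum_norm_sq_trace_pauliString_mul (star (c : Matrix (Bits n) (Bits n) ℂ) * K *
      (c : Matrix (Bits n) (Bits n) ℂ))
    rw [frobenius_mul_unitary _ c.2, frobenius_unitary_mul _ (Unitary.star_mem c.2)] at h
    rw [← h]
    refine Finset.sum_congr rfl fun s _ => ?_
    rw [mul_assoc, mul_assoc, Matrix.trace_mul_comm, mul_assoc]
  simp [this]

/-- Three of the 4^n - 1 equal nontrivial weights sit on the first qubit, and the identity weight is
counted there in full. The latter only helps, as the fraction is at most one. -/
lemma sum_firstLabel_meanWeight (hn : 1 ≤ n) (K : Matrix (Bits n) (Bits n) ℂ) :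
    3 / ((2 : ℝ) ^ (2 * n) - 1) * ∑ s, meanWeight K s ≤
      ∑ a, meanWeight K (firstLabel n a) := by
  have h1 : firstLabel n 1 ≠ 0 := fun h =>
    absurd (firstLabel_injective hn (h.trans firstLabel_zero.symm)) (by decide)
  have hA : ∑ a, meanWeight K (firstLabel n a) =
      meanWeight K 0 + 3 * meanWeight K (firstLabel n 1) := by
    rw [Fin.sum_univ_succ, firstLabel_zero, Finset.sum_congr rfl fun (a : Fin 3) _ =>
      meanWeight_eq K (t := firstLabel n 1) (fun h => absurd
        (firstLabel_injective hn (h.trans firstLabel_zero.symm)) (Fin.succ_ne_zero a)) h1]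
    simp
  have hB : ∑ s, meanWeight K s =
      meanWeight K 0 + ((2 : ℝ) ^ (2 * n) - 1) * meanWeight K (firstLabel n 1) := by
    rw [← Finset.add_sum_erase _ _ (Finset.mem_univ (0 : Fin n → Fin 4)),
      Finset.sum_congr rfl fun s hs => meanWeight_eq K (Finset.ne_of_mem_erase hs) h1,
      Finset.sum_const, Finset.card_erase_of_mem (Finset.mem_univ _), Finset.card_univ,
      nsmul_eq_mul, Nat.cast_sub Fintype.card_pos]
    simp [pow_mul]
    norm_num
  have hpow : (4 : ℝ) ≤ 2 ^ (2 * n) := by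
    rw [pow_mul]; norm_num
    exact le_self_pow₀ (by norm_num) (by omega)
  have h0 := meanWeight_nonneg K 0
  rw [hA, hB, div_mul_eq_mul_div, div_le_iff₀ (by linarith)]
  nlinarith

/-- On average over the Clifford group, a fraction `3 / (4 ^ n - 1)` of the squared norm lies on the
first qubit. -/
lemma le_integral_firstQubitWeight (hn : 1 ≤ n) (D : Matrix.unitaryGroup (Bits n) ℂ) :
    3 / ((2 : ℝ) ^ (2 * n) - 1) * frobeniusDist 1 D ^ 2 ≤
      ∫ c, firstQubitWeight
        (((c⁻¹ * D * c : Matrix.unitaryGroup (Bits n) ℂ) : Matrix (Bits n) (Bits n) ℂ) - 1)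
        ∂(cliffordMeasure n) := by
  have e (c : Matrix.unitaryGroup (Bits n) ℂ) : firstQubitWeight
      (((c⁻¹ * D * c : Matrix.unitaryGroup (Bits n) ℂ) : Matrix (Bits n) (Bits n) ℂ) - 1) =
      (∑ a, ‖Matrix.trace ((c : Matrix (Bits n) (Bits n) ℂ) * pauliString (firstLabel n a) *
        star (c : Matrix (Bits n) (Bits n) ℂ) * ((D : Matrix (Bits n) (Bits n) ℂ) - 1))‖ ^ 2) /
        2 ^ n := by
    rw [firstQubitWeight]
    congr 1
    refine Finset.sum_congr rfl fun a _ => ?_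
    have hc := Matrix.mem_unitaryGroup_iff'.mp c.2
    have e2 : ((c⁻¹ * D * c : Matrix.unitaryGroup (Bits n) ℂ) : Matrix (Bits n) (Bits n) ℂ) - 1 =
        star (c : Matrix (Bits n) (Bits n) ℂ) * ((D : Matrix (Bits n) (Bits n) ℂ) - 1) * c := by
      rw [Matrix.UnitaryGroup.mul_val, Matrix.UnitaryGroup.mul_val, mul_sub, sub_mul, mul_one, hc]
      rfl
    rw [e2, ← mul_assoc, Matrix.trace_mul_comm]
    simp only [mul_assoc]
  simp only [e]
  rw [integral_div, integral_finsetSum _ fun a _ =>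
    integrable_of_continuous _ (continuous_weight _ (firstLabel n a))]
  have h := sum_firstLabel_meanWeight hn ((D : Matrix (Bits n) (Bits n) ℂ) - 1)
  rw [sum_meanWeight] at h
  rw [frobeniusDist_comm, frobeniusDist_eq, Matrix.UnitaryGroup.one_val,
    le_div_iff₀ (by positivity)]
  refine le_trans (le_of_eq ?_) h
  ring

end CliffordMeasure

/-! ### Paths in the unitary group with short steps -/

section Geodesic

variable {ι : Type*} [Fintype ι] [DecidableEq ι]

open scoped Matrix.Norms.L2Operator in
lemma sum_norm_sq_le_l2 (A : Matrix ι ι ℂ) :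
    ∑ x, ∑ y, ‖A x y‖ ^ 2 ≤ Fintype.card ι * ‖A‖ ^ 2 := by
  rw [Finset.sum_comm, ← nsmul_eq_mul, ← Finset.card_univ, ← Finset.sum_const]
  refine Finset.sum_le_sum fun y _ => ?_
  have h := A.l2_opNorm_mulVec (EuclideanSpace.single y (1 : ℂ))
  rw [PiLp.norm_single, norm_one, mul_one] at h
  refine le_trans (le_of_eq ?_) (pow_le_pow_left₀ (norm_nonneg _) h 2)
  rw [EuclideanSpace.norm_sq_eq]
  simp

open scoped Matrix.Norms.L2Operator in
/-- Every unitary is joined to `1` by a path with `m` steps of length at most `π √N / m`. -/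
lemma exists_unitary_path (V : Matrix.unitaryGroup ι ℂ) {m : ℕ} (hm : 0 < m) :
    ∃ p : ℕ → Matrix.unitaryGroup ι ℂ, p 0 = 1 ∧ p m = V ∧
      ∀ j, frobeniusDist (p j) (p (j + 1)) ≤ Real.pi * √(Fintype.card ι) / m := by
  have hnorm : IsStarNormal (V : Matrix ι ι ℂ) := inferInstance
  -- On a finite spectrum every function is continuous, so the jump of `Complex.arg` does not
  -- obstruct the functional calculus; the path is V^{j/m}.
  have hfin : (spectrum ℂ (V : Matrix ι ι ℂ)).Finite := Matrix.finite_spectrum _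
  have hcont (f : ℂ → ℂ) : ContinuousOn f (spectrum ℂ (V : Matrix ι ι ℂ)) := hfin.continuousOn f
  let f : ℕ → ℂ → ℂ := fun j z => Complex.exp (Complex.I * ((j / m * z.arg : ℝ) : ℂ))
  have hone (j : ℕ) (z : ℂ) : ‖f j z‖ = 1 := by
    simp only [f]; rw [mul_comm]; exact Complex.norm_exp_ofReal_mul_I _
  have hU (j : ℕ) : cfc (f j) (V : Matrix ι ι ℂ) ∈ Matrix.unitaryGroup ι ℂ := by
    refine (cfc_unitary_iff (f j) _ hnorm (hcont _)).mpr fun z _ => ?_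
    rw [Complex.star_def, Complex.conj_mul', hone]; simp
  refine ⟨fun j => ⟨_, hU j⟩, ?_, ?_, fun j => ?_⟩
  · refine Subtype.ext ?_
    have : f 0 = fun _ => 1 := by funext z; simp [f]
    change cfc (f 0) (V : Matrix ι ι ℂ) = 1
    rw [this]
    exact cfc_const_one ℂ _
  · refine Subtype.ext ?_
    change cfc (f m) (V : Matrix ι ι ℂ) = V
    conv_rhs => rw [← cfc_id' ℂ (V : Matrix ι ι ℂ)]
    refine cfc_congr fun z hz => ?_
    have hz1 : ‖z‖ = 1 := spectrum.norm_eq_one_of_unitary V.2 hz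
    have hm' : (m : ℝ) ≠ 0 := by positivity
    simp only [f, div_self hm', one_mul]
    conv_rhs => rw [← Complex.norm_mul_exp_arg_mul_I z, hz1]
    rw [mul_comm]; simp
  · have hb : ‖cfc (f j) (V : Matrix ι ι ℂ) - cfc (f (j + 1)) (V : Matrix ι ι ℂ)‖ ≤
        Real.pi / m := by
      rw [← cfc_sub _ _ _ (hcont _) (hcont _)]
      refine norm_cfc_le (by positivity) fun z _ => ?_
      have e : f j z - f (j + 1) z =
          -(f j z * (Complex.exp (Complex.I * ((z.arg / m : ℝ) : ℂ)) - 1)) := by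
        simp only [f]
        rw [mul_sub, ← Complex.exp_add, mul_one]
        have : Complex.I * ((j / m * z.arg : ℝ) : ℂ) + Complex.I * ((z.arg / m : ℝ) : ℂ) =
            Complex.I * ((((j + 1 : ℕ) : ℝ) / m * z.arg : ℝ) : ℂ) := by
          push_cast; ring
        rw [this]; ring
      rw [e, norm_neg, norm_mul, hone, one_mul]
      refine (Real.norm_exp_I_mul_ofReal_sub_one_le).trans ?_
      rw [norm_div, Real.norm_eq_abs, Real.norm_natCast]
      gcongr
      exact Complex.abs_arg_le_pi z
    have h := sum_norm_sq_le_l2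
      (cfc (f j) (V : Matrix ι ι ℂ) - cfc (f (j + 1)) (V : Matrix ι ι ℂ))
    refine (abs_le_of_sq_le_sq' ?_ (by positivity)).2
    rw [frobeniusDist_sq]
    refine h.trans ?_
    rw [div_pow, mul_pow, Real.sq_sqrt (by positivity)]
    calc _ ≤ (Fintype.card ι : ℝ) * (Real.pi / m) ^ 2 := by gcongr
      _ = _ := by ring

/-- The paths of `exists_unitary_path` are chosen without measurability. Rounding to the first close
enough point of a countable dense set leaves only countably many choices. -/
lemma exists_measurable_index {δ : ℝ} (hδ : 0 < δ) :
    ∃ (e : ℕ → Matrix.unitaryGroup ι ℂ) (idx : Matrix.unitaryGroup ι ℂ → ℕ), Measurable idx ∧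
      ∀ U, frobeniusDist (e (idx U)) U < δ := by
  classical
  obtain ⟨e, he⟩ := TopologicalSpace.exists_dense_seq (Matrix.unitaryGroup ι ℂ)
  have hopen (i : ℕ) : IsOpen {U | frobeniusDist (e i) U < δ} :=
    isOpen_lt (continuous_frobeniusDist continuous_const continuous_id) continuous_const
  have hex (U : Matrix.unitaryGroup ι ℂ) : ∃ i, frobeniusDist (e i) U < δ := by
    have ho : IsOpen {V | frobeniusDist V U < δ} :=
      isOpen_lt (continuous_frobeniusDist continuous_id continuous_const) continuous_const
    exact he.exists_mem_open ho ⟨U, by simpa [frobeniusDist_self] using hδ⟩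
  exact ⟨e, fun U => Nat.find (hex U), measurable_find hex fun i => (hopen i).measurableSet,
    fun U => Nat.find_spec (hex U)⟩

/-- Paths from `1` to `U` with short steps, chosen measurably in `U`. -/
lemma exists_measurable_path {m : ℕ} (hm : 0 < m) [Nonempty ι] :
    ∃ p : Matrix.unitaryGroup ι ℂ → ℕ → Matrix.unitaryGroup ι ℂ, Measurable p ∧
      (∀ U, p U 0 = 1) ∧ (∀ U, p U (m + 1) = U) ∧
      ∀ U j, frobeniusDist (p U j) (p U (j + 1)) ≤ Real.pi * √(Fintype.card ι) / m := by
  classical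
  choose q hq0 hqm hqd using fun V : Matrix.unitaryGroup ι ℂ => exists_unitary_path V hm
  have hδ0 : 0 < Real.pi * √(Fintype.card ι) / m := by
    have : (0 : ℝ) < Fintype.card ι := by exact_mod_cast Fintype.card_pos
    positivity
  generalize Real.pi * √(Fintype.card ι) / m = δ at hqd hδ0 ⊢
  obtain ⟨e, idx, hidx, hlt⟩ := exists_measurable_index (ι := ι) hδ0
  -- The first m steps lead to the rounded endpoint; one additional step reaches `U`, after which
  -- the path is constant.
  refine ⟨fun U j => if j ≤ m then q (e (idx U)) j else U, ?_, fun U => ?_, fun U => ?_,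
    fun U j => ?_⟩
  · refine measurable_pi_lambda _ fun j => ?_
    split_ifs
    · exact (measurable_from_nat (f := fun i => q (e i) j)).comp hidx
    · exact measurable_id
  · simp [hq0]
  · simp
  · rcases lt_trichotomy j m with h | rfl | h
    · simp only [h.le, Nat.succ_le_of_lt h, if_true]
      exact hqd _ _
    · simp only [le_refl, if_true, hqm]
      simpa using (hlt U).le
    · simp [not_le.mpr h, not_le.mpr (h.trans (Nat.lt_succ_self j)), frobeniusDist_self, hδ0.le]

end Geodesic

/-! ### Path coupling and contraction of the energy -/

section Coupling

/-- The group `U(2^n)`. -/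
abbrev Gate (n : ℕ) : Type := Matrix.unitaryGroup (Bits n) ℂ

/-- The randomness `(c, u, d)` of one step of the walk. -/
abbrev Draw (n : ℕ) : Type := Gate n × Matrix.unitaryGroup (Fin 2) ℂ × Gate n

variable {n : ℕ}

/-- The first-qubit unitaries by which the points of the path `γ` are corrected after the Clifford
unitary `c`. -/
def gauge (γ : ℕ → Gate n) (c : Gate n) : ℕ → Matrix.unitaryGroup (Fin 2) ℂ
  | 0 => 1
  -- The cumulative product makes the relative gauge of neighbouring points exactly the correction
  -- of their segment.
  | j + 1 => correction (c⁻¹ * ((γ j)⁻¹ * γ (j + 1)) * c) * gauge γ c j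

/-- One step of the walk, applied to all points of a path at once. -/
def step (z : (ℕ → Gate n) × Draw n) : ℕ → Gate n := fun j =>
  z.1 j * (z.2.1 * onFirstQubit n (gauge z.1 z.2.1 j * z.2.2.1) * z.2.2.2)

/-- The law of the randomness of one step. -/
def drawLaw (n : ℕ) : Measure (Draw n) :=
  (cliffordMeasure n).prod ((haar (Fin 2)).prod (cliffordMeasure n))

instance : IsProbabilityMeasure (drawLaw n) := by unfold drawLaw; infer_instance

/-- The law of a path of walks after `k` steps. -/
def pathLaw (P : Measure (ℕ → Gate n)) : ℕ → Measure (ℕ → Gate n)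
  | 0 => P
  | k + 1 => ((pathLaw P k).prod (drawLaw n)).map step

lemma continuous_gauge (j : ℕ) :
    Continuous fun z : (ℕ → Gate n) × Gate n => gauge z.1 z.2 j := by
  induction j with
  | zero => exact continuous_const
  | succ j ih =>
    have h (i : ℕ) : Continuous fun z : (ℕ → Gate n) × Gate n => z.1 i :=
      (continuous_apply i).comp continuous_fst
    have hE : Continuous fun z : (ℕ → Gate n) × Gate n =>
        z.2⁻¹ * ((z.1 j)⁻¹ * z.1 (j + 1)) * z.2 :=
      (continuous_snd.inv.mul ((h j).inv.mul (h (j + 1)))).mul continuous_snd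
    exact (continuous_correction.comp hE).mul ih

lemma continuous_step : Continuous (step (n := n)) := by
  refine continuous_pi fun j => ?_
  have h1 : Continuous fun z : (ℕ → Gate n) × Draw n => z.1 j :=
    (continuous_apply j).comp continuous_fst
  have h2 : Continuous fun z : (ℕ → Gate n) × Draw n => z.2.1 := continuous_snd.fst
  have h3 : Continuous fun z : (ℕ → Gate n) × Draw n => z.2.2.1 := continuous_snd.snd.fst
  have h4 : Continuous fun z : (ℕ → Gate n) × Draw n => z.2.2.2 := continuous_snd.snd.snd
  have h5 : Continuous fun z : (ℕ → Gate n) × Draw n => gauge z.1 z.2.1 j :=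
    (continuous_gauge j).comp (continuous_fst.prodMk h2)
  exact h1.mul ((h2.mul (continuous_onFirstQubit.comp (h5.mul h3))).mul h4)

instance (P : Measure (ℕ → Gate n)) [IsProbabilityMeasure P] (k : ℕ) :
    IsProbabilityMeasure (pathLaw P k) := by
  induction k with
  | zero => assumption
  | succ k ih => exact Measure.isProbabilityMeasure_map continuous_step.measurable.aemeasurable

lemma lintegral_sigma {f : Gate n → ℝ≥0∞} (hf : Measurable f) :
    ∫⁻ g, f g ∂(sigma n) = ∫⁻ c, ∫⁻ u, ∫⁻ c', f (c * onFirstQubit n u * c')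
      ∂(cliffordMeasure n) ∂(haar (Fin 2)) ∂(cliffordMeasure n) := by
  have h1 : Measurable fun g : Gate n => ∫⁻ c', f (g * c') ∂(cliffordMeasure n) :=
    Measurable.lintegral_prod_right' (f := fun z : Gate n × Gate n => f (z.1 * z.2))
      (hf.comp measurable_mul)
  rw [sigma, Measure.lintegral_mconv hf, Measure.lintegral_mconv h1]
  refine lintegral_congr fun c => ?_
  exact lintegral_map (h1.comp (measurable_const_mul c)) continuous_onFirstQubit.measurable

/-- Each point of the path performs a step of the walk. -/
lemma map_eval_step (P : Measure (ℕ → Gate n)) [IsProbabilityMeasure P] (j : ℕ) :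
    ((P.prod (drawLaw n)).map step).map (fun γ => γ j) =
      Measure.mconv (P.map fun γ => γ j) (sigma n) := by
  refine Measure.ext_of_lintegral _ fun f hf => ?_
  have hj : Measurable fun γ : ℕ → Gate n => γ j := measurable_pi_apply j
  have hs := (continuous_step (n := n)).measurable
  have hF : Measurable fun z : (ℕ → Gate n) × Draw n => f (step z j) := hf.comp (hj.comp hs)
  have hfj : Measurable fun γ : ℕ → Gate n => f (γ j) := hf.comp hj
  rw [lintegral_map hf hj, lintegral_map hfj hs, Measure.lintegral_mconv hf,
    lintegral_map (Measurable.lintegral_prod_right' (f := fun z : Gate n × Gate n => f (z.1 * z.2))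
      (hf.comp measurable_mul)) hj, lintegral_prod _ hF.aemeasurable]
  refine lintegral_congr fun γ => ?_
  refine Eq.trans ?_ (lintegral_sigma (hf.comp (measurable_const_mul (γ j)))).symm
  have h1 : Measurable fun w : Draw n => f (step (γ, w) j) := hF.comp measurable_prodMk_left
  rw [drawLaw, lintegral_prod _ h1.aemeasurable]
  refine lintegral_congr fun c => ?_
  have h2 : Measurable fun w : Matrix.unitaryGroup (Fin 2) ℂ × Gate n =>
      f (step (γ, c, w) j) := h1.comp measurable_prodMk_left
  rw [lintegral_prod _ h2.aemeasurable]
  -- The gauge depends on `γ` and `c` but not on `u`, so left invariance absorbs it.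
  exact lintegral_mul_left_eq_self (μ := haar (Fin 2)) (fun u => ∫⁻ c',
    f (γ j * (c * onFirstQubit n u * c')) ∂(cliffordMeasure n)) (gauge γ c j)

lemma map_eval_pathLaw_of_dirac (P : Measure (ℕ → Gate n)) [IsProbabilityMeasure P] (j k : ℕ)
    (h : P.map (fun γ => γ j) = Measure.dirac 1) :
    (pathLaw P k).map (fun γ => γ j) = convPow (sigma n) k := by
  induction k with
  | zero => exact h
  | succ k ih => rw [pathLaw, map_eval_step, ih, convPow]

lemma haar_mconv (ν : Measure (Gate n)) [IsProbabilityMeasure ν] :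
    Measure.mconv (haar (Bits n)) ν = haar (Bits n) := by
  refine Measure.ext_of_lintegral _ fun f hf => ?_
  have h : Measurable (Function.uncurry fun x y : Gate n => f (x * y)) := hf.comp measurable_mul
  rw [Measure.lintegral_mconv hf, lintegral_lintegral_swap h.aemeasurable]
  simp [lintegral_mul_right_eq_self]

lemma map_eval_pathLaw_of_haar (P : Measure (ℕ → Gate n)) [IsProbabilityMeasure P] (j k : ℕ)
    (h : P.map (fun γ => γ j) = haar (Bits n)) :
    (pathLaw P k).map (fun γ => γ j) = haar (Bits n) := by
  induction k with
  | zero => exact h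
  | succ k ih => rw [pathLaw, map_eval_step, ih, haar_mconv]

lemma frobeniusDist_one_conj (γ : ℕ → Gate n) (c : Gate n) (j : ℕ) :
    frobeniusDist 1 (c⁻¹ * ((γ j)⁻¹ * γ (j + 1)) * c) = frobeniusDist (γ j) (γ (j + 1)) := by
  rw [← frobeniusDist_mul_right _ _ c⁻¹, ← frobeniusDist_mul_left c,
    ← frobeniusDist_mul_left (γ j)]
  congr 1 <;> group

/-- By bi-invariance all common factors cancel, in particular `u`, `c'` and the accumulated gauge.
-/
lemma frobeniusDist_step (γ : ℕ → Gate n) (w : Draw n) (j : ℕ) :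
    frobeniusDist (step (γ, w) j) (step (γ, w) (j + 1)) =
      frobeniusDist 1 (w.1⁻¹ * ((γ j)⁻¹ * γ (j + 1)) * w.1 *
        onFirstQubit n (correction (w.1⁻¹ * ((γ j)⁻¹ * γ (j + 1)) * w.1))) := by
  obtain ⟨c, u, c'⟩ := w
  simp only [step, gauge, onFirstQubit_mul]
  generalize correction (c⁻¹ * ((γ j)⁻¹ * γ (j + 1)) * c) = W
  generalize gauge γ c j = V
  rw [← frobeniusDist_mul_left ((γ j * c)⁻¹),
    ← frobeniusDist_mul_right _ _ ((onFirstQubit n V * onFirstQubit n u * c')⁻¹)]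
  congr 1 <;> group

/-- The Lipschitz constant of a step. -/
def stepBound (n : ℕ) : ℝ := 1 + √(Fintype.card (Bits n))

lemma one_le_stepBound : 1 ≤ stepBound n := by
  unfold stepBound; linarith [Real.sqrt_nonneg (Fintype.card (Bits n))]

lemma frobeniusDist_step_le (hn : 1 ≤ n) (γ : ℕ → Gate n) (w : Draw n) (j : ℕ) :
    frobeniusDist (step (γ, w) j) (step (γ, w) (j + 1)) ≤
      stepBound n * frobeniusDist (γ j) (γ (j + 1)) := by
  rw [frobeniusDist_step]
  refine (frobeniusDist_correction_le hn _).trans ?_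
  rw [frobeniusDist_one_conj, stepBound]
  -- The diameter bound d ≤ 2√N turns d + d²/2 into (1 + √N) d.
  have h1 := frobeniusDist_le (γ j) (γ (j + 1))
  have h2 := frobeniusDist_nonneg (γ j) (γ (j + 1))
  nlinarith

/-- The error term of `energy_step_le` needs an almost sure bound on lengths. The growth factor is
harmless because it does not depend on δ. -/
lemma ae_pathLaw (hn : 1 ≤ n) (P : Measure (ℕ → Gate n)) [IsProbabilityMeasure P] {δ : ℝ}
    (hP : ∀ᵐ γ ∂P, ∀ j, frobeniusDist (γ j) (γ (j + 1)) ≤ δ) (k : ℕ) :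
    ∀ᵐ γ ∂(pathLaw P k), ∀ j, frobeniusDist (γ j) (γ (j + 1)) ≤ stepBound n ^ k * δ := by
  induction k with
  | zero => simpa [pathLaw] using hP
  | succ k ih =>
    have hm : MeasurableSet {γ : ℕ → Gate n | ∀ j,
        frobeniusDist (γ j) (γ (j + 1)) ≤ stepBound n ^ (k + 1) * δ} := by
      rw [Set.ofPred_forall]
      exact MeasurableSet.iInter fun j => (isClosed_le (continuous_frobeniusDist
        (continuous_apply j) (continuous_apply (j + 1))) continuous_const).measurableSet
    rw [pathLaw, ae_map_iff continuous_step.measurable.aemeasurable hm]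
    have h2 := Measure.quasiMeasurePreserving_fst (μ := pathLaw P k) (ν := drawLaw n) |>.ae ih
    filter_upwards [h2] with z hz j
    refine (frobeniusDist_step_le hn z.1 z.2 j).trans ?_
    rw [pow_succ', mul_assoc]
    exact mul_le_mul_of_nonneg_left (hz j) (zero_le_one.trans one_le_stepBound)

lemma continuous_firstQubitWeight_conj (j : ℕ) :
    Continuous fun z : (ℕ → Gate n) × Gate n => firstQubitWeight
      (((z.2⁻¹ * ((z.1 j)⁻¹ * z.1 (j + 1)) * z.2 : Gate n) : Matrix (Bits n) (Bits n) ℂ) - 1) := by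
  have h (i : ℕ) : Continuous fun z : (ℕ → Gate n) × Gate n => z.1 i :=
    (continuous_apply i).comp continuous_fst
  have hE : Continuous fun z : (ℕ → Gate n) × Gate n =>
      z.2⁻¹ * ((z.1 j)⁻¹ * z.1 (j + 1)) * z.2 :=
    (continuous_snd.inv.mul ((h j).inv.mul (h (j + 1)))).mul continuous_snd
  have hK : Continuous fun z : (ℕ → Gate n) × Gate n =>
      ((z.2⁻¹ * ((z.1 j)⁻¹ * z.1 (j + 1)) * z.2 : Gate n) : Matrix (Bits n) (Bits n) ℂ) - 1 :=
    (continuous_subtype_val.comp hE).sub continuous_const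
  refine Continuous.div_const (continuous_finsetSum _ fun a _ => ?_) _
  exact ((Continuous.matrix_mul (A := fun _ => pauliString (firstLabel n a))
    continuous_const hK).matrix_trace.norm).pow 2

/-- The mean squared length of the `j`-th segment. -/
def energy (P : Measure (ℕ → Gate n)) (j : ℕ) : ℝ :=
  ∫ γ, frobeniusDist (γ j) (γ (j + 1)) ^ 2 ∂P

lemma continuous_segment (j : ℕ) :
    Continuous fun γ : ℕ → Gate n => frobeniusDist (γ j) (γ (j + 1)) :=
  continuous_frobeniusDist (continuous_apply j) (continuous_apply (j + 1))

/-- The pointwise bound `frobeniusDist_correction_sq_le` is integrated, first over `c` for a fixed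
path, where the Clifford average supplies the contraction. -/
lemma energy_step_le (hn : 1 ≤ n) (P : Measure (ℕ → Gate n)) [IsProbabilityMeasure P] {r : ℝ}
    (j : ℕ) (hP : ∀ᵐ γ ∂P, frobeniusDist (γ j) (γ (j + 1)) ≤ r) :
    energy ((P.prod (drawLaw n)).map step) j ≤
      (1 - 3 / ((2 : ℝ) ^ (2 * n) - 1)) * energy P j + (r ^ 3 + 2 * r ^ 4) := by
  set α := 3 / ((2 : ℝ) ^ (2 * n) - 1) with hα
  let w : (ℕ → Gate n) × Gate n → ℝ := fun z => firstQubitWeight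
    (((z.2⁻¹ * ((z.1 j)⁻¹ * z.1 (j + 1)) * z.2 : Gate n) : Matrix (Bits n) (Bits n) ℂ) - 1)
  have hw : Continuous w := continuous_firstQubitWeight_conj j
  have hd : Continuous fun γ : ℕ → Gate n => frobeniusDist (γ j) (γ (j + 1)) ^ 2 :=
    (continuous_segment j).pow 2
  have hw' : Continuous fun z : (ℕ → Gate n) × Draw n => w (z.1, z.2.1) :=
    hw.comp (continuous_fst.prodMk continuous_snd.fst)
  have hd' : Continuous fun z : (ℕ → Gate n) × Draw n =>
      frobeniusDist (z.1 j) (z.1 (j + 1)) ^ 2 := hd.comp continuous_fst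
  have hae : ∀ᵐ z ∂(P.prod (drawLaw n)), frobeniusDist (step z j) (step z (j + 1)) ^ 2 ≤
      frobeniusDist (z.1 j) (z.1 (j + 1)) ^ 2 - w (z.1, z.2.1) + (r ^ 3 + 2 * r ^ 4) := by
    have h2 := Measure.quasiMeasurePreserving_fst (μ := P) (ν := drawLaw n) |>.ae hP
    filter_upwards [h2] with z hz
    have h := frobeniusDist_correction_sq_le hn (z.2.1⁻¹ * ((z.1 j)⁻¹ * z.1 (j + 1)) * z.2.1)
    rw [← frobeniusDist_step z.1 z.2 j, frobeniusDist_one_conj] at h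
    have h0 := frobeniusDist_nonneg (z.1 j) (z.1 (j + 1))
    have h3 := pow_le_pow_left₀ h0 hz 3
    have h4 := pow_le_pow_left₀ h0 hz 4
    refine h.trans ?_
    simp only [w]
    linarith
  have hwint : ∫ z, w (z.1, z.2.1) ∂(P.prod (drawLaw n)) =
      ∫ γ, ∫ c, w (γ, c) ∂(cliffordMeasure n) ∂P := by
    rw [integral_prod _ (integrable_of_continuous _ hw')]
    refine integral_congr_ae (Filter.Eventually.of_forall fun γ => ?_)
    simp only [drawLaw]
    rw [integral_fun_fst (fun c => w (γ, c))]
    simp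
  have hdint : ∫ z, frobeniusDist (z.1 j) (z.1 (j + 1)) ^ 2 ∂(P.prod (drawLaw n)) =
      energy P j := by
    rw [integral_fun_fst (fun γ : ℕ → Gate n => frobeniusDist (γ j) (γ (j + 1)) ^ 2)]
    simp [energy]
  have hlow : α * energy P j ≤ ∫ γ, ∫ c, w (γ, c) ∂(cliffordMeasure n) ∂P := by
    rw [energy, ← integral_const_mul]
    refine integral_mono ((integrable_of_continuous _ hd).const_mul α)
      (integrable_of_continuous (P.prod (cliffordMeasure n)) hw).integral_prod_left fun γ => ?_
    have h := le_integral_firstQubitWeight hn ((γ j)⁻¹ * γ (j + 1))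
    rw [← frobeniusDist_mul_left (γ j), mul_one, mul_inv_cancel_left] at h
    exact h
  rw [energy, integral_map continuous_step.measurable.aemeasurable hd.aestronglyMeasurable]
  calc _ ≤ ∫ z, (frobeniusDist (z.1 j) (z.1 (j + 1)) ^ 2 - w (z.1, z.2.1) +
        (r ^ 3 + 2 * r ^ 4)) ∂(P.prod (drawLaw n)) :=
        integral_mono_ae (integrable_of_continuous _ (hd.comp continuous_step))
          (integrable_of_continuous _ ((hd'.sub hw').add continuous_const)) hae
    _ = energy P j - ∫ γ, ∫ c, w (γ, c) ∂(cliffordMeasure n) ∂P + (r ^ 3 + 2 * r ^ 4) := by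
        have hsub : Integrable (fun z : (ℕ → Gate n) × Draw n =>
            frobeniusDist (z.1 j) (z.1 (j + 1)) ^ 2 - w (z.1, z.2.1)) (P.prod (drawLaw n)) :=
          integrable_of_continuous _ (hd'.sub hw')
        rw [integral_add hsub (integrable_const _),
          integral_sub (integrable_of_continuous _ hd') (integrable_of_continuous _ hw'), hwint,
          hdint]
        simp
    _ ≤ _ := by linarith

lemma rate_mem (hn : 1 ≤ n) : 0 ≤ 1 - 3 / ((2 : ℝ) ^ (2 * n) - 1) ∧
    1 - 3 / ((2 : ℝ) ^ (2 * n) - 1) ≤ 1 := by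
  have hpow : (4 : ℝ) ≤ 2 ^ (2 * n) := by
    rw [pow_mul]; norm_num
    exact le_self_pow₀ (by norm_num) (by omega)
  have h1 : 3 / ((2 : ℝ) ^ (2 * n) - 1) ≤ 1 := by
    rw [div_le_one (by linarith)]; linarith
  have h2 : 0 ≤ 3 / ((2 : ℝ) ^ (2 * n) - 1) := div_nonneg (by norm_num) (by linarith)
  constructor <;> linarith

/-- Up to a cubic error, the energy of a segment decays geometrically. -/
lemma exists_energy_pathLaw_le (hn : 1 ≤ n) (k : ℕ) :
    ∃ C : ℝ, ∀ (P : Measure (ℕ → Gate n)) [IsProbabilityMeasure P] (δ : ℝ), 0 ≤ δ →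
      (∀ᵐ γ ∂P, ∀ j, frobeniusDist (γ j) (γ (j + 1)) ≤ δ) → ∀ j, energy (pathLaw P k) j ≤
        (1 - 3 / ((2 : ℝ) ^ (2 * n) - 1)) ^ k * δ ^ 2 + C * (δ ^ 3 + δ ^ 4) := by
  obtain ⟨hq0, hq1⟩ := rate_mem hn
  induction k with
  | zero =>
    refine ⟨0, fun P _ δ hδ hP j => ?_⟩
    rw [pow_zero, one_mul, zero_mul, add_zero, energy]
    calc _ ≤ ∫ _, δ ^ 2 ∂P := integral_mono_ae
          (integrable_of_continuous _ ((continuous_segment j).pow 2)) (integrable_const _) (by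
            filter_upwards [hP] with γ hγ
            exact pow_le_pow_left₀ (frobeniusDist_nonneg _ _) (hγ j) 2)
      _ = δ ^ 2 := by simp
  | succ k ih =>
    obtain ⟨C, hC⟩ := ih
    -- The old error is not amplified, as the rate lies in [0, 1]; the other two terms are the new
    -- error at r = `stepBound n ^ k * δ`.
    refine ⟨|C| + (stepBound n ^ k) ^ 3 + 2 * (stepBound n ^ k) ^ 4, fun P _ δ hδ hP j => ?_⟩
    have h1 := hC P δ hδ hP j
    have h2 := energy_step_le hn (pathLaw P k) j
      ((ae_pathLaw hn P hP k).mono fun γ hγ => hγ j)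
    rw [pathLaw]
    have hL : 0 ≤ stepBound n ^ k := pow_nonneg (zero_le_one.trans one_le_stepBound) k
    generalize stepBound n ^ k = L at *
    generalize 1 - 3 / ((2 : ℝ) ^ (2 * n) - 1) = q at *
    refine h2.trans ?_
    have h3 := mul_le_mul_of_nonneg_left h1 hq0
    have hd3 : 0 ≤ δ ^ 3 := pow_nonneg hδ 3
    have hd4 : 0 ≤ δ ^ 4 := pow_nonneg hδ 4
    have h4 : q * (C * (δ ^ 3 + δ ^ 4)) ≤ |C| * (δ ^ 3 + δ ^ 4) := by
      rw [← mul_assoc]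
      refine mul_le_mul_of_nonneg_right ?_ (by positivity)
      calc q * C ≤ q * |C| := mul_le_mul_of_nonneg_left (le_abs_self C) hq0
        _ ≤ |C| := mul_le_of_le_one_left (abs_nonneg C) hq1
    have h5 : 0 ≤ L ^ 3 * δ ^ 4 := by positivity
    have h6 : 0 ≤ L ^ 4 * δ ^ 3 := by positivity
    rw [mul_pow, mul_pow, pow_succ q]
    nlinarith

/-! ### From segment energies to the Wasserstein distance -/

lemma sq_frobeniusDist_le_sum (γ : ℕ → Gate n) (m : ℕ) :
    frobeniusDist (γ 0) (γ m) ^ 2 ≤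
      m * ∑ j ∈ Finset.range m, frobeniusDist (γ j) (γ (j + 1)) ^ 2 := by
  refine (pow_le_pow_left₀ (frobeniusDist_nonneg _ _) (frobeniusDist_le_sum γ m) 2).trans ?_
  simpa using sq_sum_le_card_mul_sum_sq (s := Finset.range m)
    (f := fun j => frobeniusDist (γ j) (γ (j + 1)))

/-- The joint law of the two endpoints is the coupling. One factor m comes from Cauchy–Schwarz, the
other from summing m energies. -/
lemma wasserstein_le_of_path (P : Measure (ℕ → Gate n)) [IsProbabilityMeasure P] {m : ℕ} {B : ℝ}
    (hB : ∀ j, energy P j ≤ B) :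
    wasserstein frobeniusDist 2 (P.map fun γ => γ 0) (P.map fun γ => γ m) ≤
      ENNReal.ofReal ((m : ℝ) ^ 2 * B) ^ (1 / 2 : ℝ) := by
  have hm : Measurable fun γ : ℕ → Gate n => (γ 0, γ m) :=
    (measurable_pi_apply 0).prodMk (measurable_pi_apply m)
  have hcpl : IsCoupling (P.map fun γ => (γ 0, γ m)) (P.map fun γ => γ 0) (P.map fun γ => γ m) :=
    ⟨Measure.map_map measurable_fst hm, Measure.map_map measurable_snd hm⟩
  unfold wasserstein
  refine (iInf₂_le (P.map fun γ => (γ 0, γ m)) hcpl).trans ?_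
  refine ENNReal.rpow_le_rpow ?_ (by norm_num)
  have hc : Continuous fun γ : ℕ → Gate n => frobeniusDist (γ 0) (γ m) ^ 2 :=
    (continuous_frobeniusDist (continuous_apply 0) (continuous_apply m)).pow 2
  have hd : Continuous fun z : Gate n × Gate n => frobeniusDist z.1 z.2 :=
    continuous_frobeniusDist continuous_fst continuous_snd
  rw [lintegral_map (hd.measurable.ennreal_ofReal.pow_const (2 : ℝ)) hm]
  have e (γ : ℕ → Gate n) : ENNReal.ofReal (frobeniusDist (γ 0) (γ m)) ^ (2 : ℝ) =
      ENNReal.ofReal (frobeniusDist (γ 0) (γ m) ^ 2) := by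
    rw [ENNReal.ofReal_pow (frobeniusDist_nonneg _ _)]
    exact ENNReal.rpow_natCast _ 2
  simp only [e]
  rw [← ofReal_integral_eq_lintegral_ofReal (integrable_of_continuous _ hc)
    (Filter.Eventually.of_forall fun γ => sq_nonneg _)]
  refine ENNReal.ofReal_le_ofReal ?_
  have hi (j : ℕ) : Integrable (fun γ : ℕ → Gate n => frobeniusDist (γ j) (γ (j + 1)) ^ 2) P :=
    integrable_of_continuous _ ((continuous_segment j).pow 2)
  calc _ ≤ ∫ γ, (m : ℝ) * ∑ j ∈ Finset.range m, frobeniusDist (γ j) (γ (j + 1)) ^ 2 ∂P :=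
        integral_mono (integrable_of_continuous _ hc)
          ((integrable_finsetSum _ fun j _ => hi j).const_mul _)
          fun γ => sq_frobeniusDist_le_sum γ m
    _ = m * ∑ j ∈ Finset.range m, energy P j := by
        rw [integral_const_mul, integral_finsetSum _ fun j _ => hi j]; rfl
    _ ≤ m * ∑ j ∈ Finset.range m, B := by gcongr with j _; exact hB j
    _ = (m : ℝ) ^ 2 * B := by simp; ring

lemma wasserstein_le_of_steps (hn : 1 ≤ n) (k : ℕ) :
    ∃ C : ℝ, ∀ m : ℕ, 0 < m → wasserstein frobeniusDist 2 (convPow (sigma n) k) (haar (Bits n)) ≤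
      ENNReal.ofReal (((m + 1 : ℕ) : ℝ) ^ 2 * ((1 - 3 / ((2 : ℝ) ^ (2 * n) - 1)) ^ k *
        (Real.pi * √(Fintype.card (Bits n)) / m) ^ 2 +
          C * ((Real.pi * √(Fintype.card (Bits n)) / m) ^ 3 +
            (Real.pi * √(Fintype.card (Bits n)) / m) ^ 4))) ^ (1 / 2 : ℝ) := by
  obtain ⟨C, hC⟩ := exists_energy_pathLaw_le hn k
  refine ⟨C, fun m hm => ?_⟩
  obtain ⟨p, hp, hp0, hpm, hpd⟩ := exists_measurable_path (ι := Bits n) hm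
  let P : Measure (ℕ → Gate n) := (haar (Bits n)).map p
  have : IsProbabilityMeasure P := Measure.isProbabilityMeasure_map hp.aemeasurable
  have hδ : ∀ᵐ γ ∂P, ∀ j, frobeniusDist (γ j) (γ (j + 1)) ≤
      Real.pi * √(Fintype.card (Bits n)) / m := by
    refine (ae_map_iff hp.aemeasurable ?_).mpr (Filter.Eventually.of_forall hpd)
    rw [Set.ofPred_forall]
    exact MeasurableSet.iInter fun j =>
      (isClosed_le (continuous_segment j) continuous_const).measurableSet
  have h0 : P.map (fun γ => γ 0) = Measure.dirac 1 := by
    rw [Measure.map_map (measurable_pi_apply 0) hp]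
    have : (fun γ : ℕ → Gate n => γ 0) ∘ p = fun _ => 1 := funext hp0
    rw [this, Measure.map_const]
    simp
  have h1 : P.map (fun γ => γ (m + 1)) = haar (Bits n) := by
    rw [Measure.map_map (measurable_pi_apply (m + 1)) hp]
    have : (fun γ : ℕ → Gate n => γ (m + 1)) ∘ p = id := funext hpm
    rw [this, Measure.map_id]
  have h := wasserstein_le_of_path (pathLaw P k) (m := m + 1)
    (hC P _ (by positivity) hδ)
  rwa [map_eval_pathLaw_of_dirac P 0 k h0, map_eval_pathLaw_of_haar P (m + 1) k h1] at h

/-- The quadratic growth of the prefactor exactly balances the main term, while the cubic and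
quartic errors contribute O(1/m). -/
lemma tendsto_step_bound (q D C : ℝ) :
    Filter.Tendsto (fun m : ℕ => ((m + 1 : ℕ) : ℝ) ^ 2 * (q * (D / m) ^ 2 +
      C * ((D / m) ^ 3 + (D / m) ^ 4))) Filter.atTop (nhds (q * D ^ 2)) := by
  have hinv : Filter.Tendsto (fun m : ℕ => ((m : ℝ))⁻¹) Filter.atTop (nhds 0) :=
    tendsto_inv_atTop_nhds_zero_nat
  have h : Filter.Tendsto (fun m : ℕ => (1 + (m : ℝ)⁻¹) ^ 2 * (q * D ^ 2 +
      C * (D ^ 3 * (m : ℝ)⁻¹ + D ^ 4 * (m : ℝ)⁻¹ ^ 2))) Filter.atTop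
      (nhds ((1 + 0) ^ 2 * (q * D ^ 2 + C * (D ^ 3 * 0 + D ^ 4 * 0 ^ 2)))) :=
    ((hinv.const_add 1).pow 2).mul ((((hinv.const_mul (D ^ 3)).add
      ((hinv.pow 2).const_mul (D ^ 4))).const_mul C).const_add _)
  have e : (1 + 0) ^ 2 * (q * D ^ 2 + C * (D ^ 3 * 0 + D ^ 4 * 0 ^ 2)) = q * D ^ 2 := by ring
  rw [e] at h
  refine h.congr' ?_
  filter_upwards [Filter.eventually_gt_atTop 0] with m hm
  have : (m : ℝ) ≠ 0 := by positivity
  push_cast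
  field_simp

end Coupling

end CliffordWalk

end

theorem lemma5 (n : ℕ) (hn : 1 ≤ n) (k : ℕ) (hk : 1 ≤ k) :
    CliffordWalk.wasserstein CliffordWalk.frobeniusDist 2
        (CliffordWalk.convPow (CliffordWalk.sigma n) k)
        (CliffordWalk.haar (CliffordWalk.Bits n)) ≤
      ENNReal.ofReal
        ((1 - 3 / ((2 : ℝ) ^ (2 * n) - 1)) ^ ((k : ℝ) / 2) * (Real.pi * 2 ^ ((n : ℝ) / 2))) := by
  obtain ⟨C, hC⟩ := CliffordWalk.wasserstein_le_of_steps hn k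
  obtain ⟨hq, -⟩ := CliffordWalk.rate_mem hn
  -- `C` is fixed before the number of steps, so the bound survives the limit of infinitely fine
  -- paths.
  have hlim := ((ENNReal.continuous_rpow_const (y := (1 / 2 : ℝ))).tendsto _).comp
    (ENNReal.tendsto_ofReal (CliffordWalk.tendsto_step_bound
      ((1 - 3 / ((2 : ℝ) ^ (2 * n) - 1)) ^ k)
      (Real.pi * √(Fintype.card (CliffordWalk.Bits n))) C))
  refine (ge_of_tendsto hlim ?_).trans (le_of_eq ?_)
  · filter_upwards [Filter.eventually_gt_atTop 0] with m hm
    exact hC m hm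
  · rw [ENNReal.ofReal_rpow_of_nonneg (by positivity) (by norm_num)]
    congr 1
    generalize 1 - 3 / ((2 : ℝ) ^ (2 * n) - 1) = q at *
    rw [Real.mul_rpow (by positivity) (by positivity), ← Real.sqrt_eq_rpow ((_ * _) ^ 2),
      Real.sqrt_sq (by positivity), ← Real.rpow_natCast q k, ← Real.rpow_mul hq,
      CliffordWalk.card_bits]
    congr 2
    · ring
    · push_cast
      rw [Real.sqrt_eq_rpow, ← Real.rpow_natCast 2 n, ← Real.rpow_mul (by norm_num)]
      congr 1
      ring
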